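/- Let $R$ be a commutative ring with unit and let $\mathcal P$ be a (small) filtered poset: for every $p\in\mathcal P$ the maximum $d(p)=\max\{n \mid c_0\prec c_1\prec\dots\prec c_n=p\}$ of the lengths of unrefinable chains ending at $p$ exists ($\prec$ being the cover relation), and $d\colon\mathcal P\to\mathbb N$ is strictly order preserving. Let $\mathrm{Ch}(R)$ be the category of unbounded cochain complexes of $R$-modules, and for $p\in\mathcal P$ put $\mathcal P_{<p}=\{q\in\mathcal P\mid q<p\}$. For a poset $\mathcal Q$ and a functor $F\colon\mathcal Q^{\mathrm{op}}\to R\text{-mod}$ let $H^n(\mathcal Q;F)$ be the $n$-th right derived functor of $\lim\colon \mathrm{Fun}(\mathcal Q^{\mathrm{op}},R\text{-mod})\to R\text{-mod}$ evaluated at $F$, with $H^n(\mathcal Q;F)=0$ for $n<0$. Regard $R$-modules as complexes concentrated in degree $0$. For a morphism $f\colon C\to D$ in $\mathrm{Ch}(R)$, the mapping cocylinder $\mathrm{cocyl}(f)$ has $\mathrm{cocyl}(f)^n=C^n\times D^{n-1}\times D^n$ and $\partial(c,d,d')=(\partial c,\,d'-f(c)-\partial d,\,\partial d')$; it comes with the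 morphisms $i\colon C\to\mathrm{cocyl}(f)$, $c\mapsto(c,0,f(c))$, and $\pi\colon\mathrm{cocyl}(f)\to D$, $(c,d,d')\mapsto d'$. For $F\colon\mathcal P^{\mathrm{op}}\to R\text{-mod}$, the cocylinder $\mathbf RF\colon\mathcal P^{\mathrm{op}}\to\mathrm{Ch}(R)$, together with a natural transformation $F\to\mathbf RF$, is defined inductively by $$\mathbf RF(p)=\mathrm{cocyl}\Bigl(F(p)\to\lim_{\mathcal P_{<p}}F\to\lim_{\mathcal P_{<p}}\mathbf RF\Bigr),$$ where $\mathbf RF(p)\to\mathbf RF(q)$ for $q<p$ is $\pi$ followed by the projection $\lim_{\mathcal P_{<p}}\mathbf RF\to\mathbf RF(q)$, and $F(p)\to\mathbf RF(p)$ is $i$. Then there is a model category structure on $\mathrm{Fun}(\mathcal P^{\mathrm{op}},\mathrm{Ch}(R))$ in which a natural transformation $\eta\colon F\to G$ is * a weak equivalence if and only if $H^n(\eta_p)$ is an isomorphism for all $p\in\mathcal P$ and $n\in\mathbb Z$; * a cofibration if and only if, for every $p\in\mathcal P$, $\eta_p$ is a cofibration of the projective model structure on $\mathrm{Ch}(R)$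 (it has the left lifting property against all degreewise surjective quasi-isomorphisms); * a fibration if and only if, for every $p\in\mathcal P$, the map $F(p)\to\lim_{\mathcal P_{<p}}F\times_{\lim_{\mathcal P_{<p}}G}G(p)$ is degreewise surjective. In this model structure: 1. a functor $G$ is fibrant if and only if the natural map $G(p)\to\lim_{\mathcal P_{<p}}G$ is degreewise surjective for every $p\in\mathcal P$; 2. for every $F\colon\mathcal P^{\mathrm{op}}\to R\text{-mod}$ and every fibrant replacement $F\to G$ of $F$ (a weak equivalence to a fibrant object), $H^n(\mathcal P;F)\cong H^n(\lim_{\mathcal P}G)$ for all $n\in\mathbb Z$; 3. for every $F\colon\mathcal P^{\mathrm{op}}\to R\text{-mod}$, the natural transformation $F\to\mathbf RF$ is a fibrant replacement of $F$; 4. for every $F\colon\mathcal P^{\mathrm{op}}\to R\text{-mod}$, every $p\in\mathcal P$ and every $n\in\mathbb Z$, $H^n(\mathcal P_{<p};F|_{\mathcal P_{<p}})\cong H^n\bigl(\lim_{\mathcal P_{<p}}\mathbf RF\bigr)$. -/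

import Mathlib

open CategoryTheory Limits Opposite HomotopicalAlgebra

universe u

noncomputable section

/-! ### Filtered posets -/

/-- `p` is the top element `c_n` of an unrefinable chain `c_0 ⋖ c_1 ⋖ ⋯ ⋖ c_n` of length `n`. -/
def IsUnrefinableChainTop {P : Type u} [PartialOrder P] (p : P) (n : ℕ) : Prop :=
  ∃ c : Fin (n + 1) → P, c (Fin.last n) = p ∧ ∀ i : Fin n, c i.castSucc ⋖ c i.succ

/-- The degree of `p`: the maximal length of an unrefinable chain ending at `p`
(it is only meaningful when these lengths are bounded). -/
def posetDegree {P : Type u} [PartialOrder P] (p : P) : ℕ :=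
  sSup {n : ℕ | IsUnrefinableChainTop p n}

/-- A poset is filtered if the degree is well defined, that is, the maximum in its definition
exists, and is strictly order preserving. -/
class FilteredPoset (P : Type u) [PartialOrder P] : Prop where
  bddAbove : ∀ p : P, BddAbove {n : ℕ | IsUnrefinableChainTop p n}
  strictMono : StrictMono (posetDegree : P → ℕ)

instance FilteredPoset.wellFoundedLT {P : Type u} [PartialOrder P] [FilteredPoset P] :
    WellFoundedLT P :=
  ⟨Subrelation.wf (fun {_ _} h => FilteredPoset.strictMono h)
    (InvImage.wf (posetDegree : P → ℕ) wellFounded_lt)⟩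

/-! ### Functors over a poset and their limits over `P_{<p}` -/

/-- The inclusion of the subposet `P_{<p}`. -/
abbrev inclLT {P : Type u} [PartialOrder P] (p : P) : Set.Iio p ⥤ P :=
  Monotone.functor (f := fun q : Set.Iio p => (q : P)) fun _ _ h => h

/-- The restriction to `P_{<p}` of a contravariant functor on `P`. -/
abbrev restrictLT {P : Type u} [PartialOrder P] {C : Type*} [Category C]
    (G : Pᵒᵖ ⥤ C) (p : P) : (Set.Iio p)ᵒᵖ ⥤ C :=
  (inclLT p).op ⋙ G

/-- The restriction to `P_{<p}` of a natural transformation. -/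
abbrev restrictLTMap {P : Type u} [PartialOrder P] {C : Type*} [Category C]
    {F G : Pᵒᵖ ⥤ C} (η : F ⟶ G) (p : P) : restrictLT F p ⟶ restrictLT G p :=
  Functor.whiskerLeft (inclLT p).op η

/-- The natural map `G(p) → lim_{P_{<p}} G`. -/
def matchingMap {P : Type u} [PartialOrder P] {C : Type*} [Category C] [HasLimitsOfSize.{u, u} C]
    (G : Pᵒᵖ ⥤ C) (p : P) : G.obj (op p) ⟶ limit (restrictLT G p) :=
  limit.lift (restrictLT G p)
    { pt := G.obj (op p)
      π :=
        { app := fun q => G.map (homOfLE q.unop.2.le).op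
          naturality := fun q r f =>
            (Category.id_comp _).trans (G.map_comp (homOfLE q.unop.2.le).op _) } }

theorem matchingMap_naturality {P : Type u} [PartialOrder P] {C : Type*} [Category C]
    [HasLimitsOfSize.{u, u} C] {F G : Pᵒᵖ ⥤ C} (η : F ⟶ G) (p : P) :
    matchingMap F p ≫ limMap (restrictLTMap η p) = η.app (op p) ≫ matchingMap G p := by
  apply limit.hom_ext
  intro q
  rw [Category.assoc, Category.assoc, limMap_π, matchingMap, matchingMap, limit.lift_π,
    limit.lift_π_assoc]
  exact η.naturality _

/-- The relative matching map `F(p) → lim_{P_{<p}} F ×_{lim_{P_{<p}} G} G(p)`. -/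
def relativeMatchingMap {P : Type u} [PartialOrder P] {C : Type*} [Category C]
    [HasLimitsOfSize.{u, u} C] [HasPullbacks C] {F G : Pᵒᵖ ⥤ C} (η : F ⟶ G) (p : P) :
    F.obj (op p) ⟶ pullback (limMap (restrictLTMap η p)) (matchingMap G p) :=
  pullback.lift (matchingMap F p) (η.app (op p)) (matchingMap_naturality η p)

/-! ### Cohomology of a poset: higher limits -/

instance limFunctor_additive {R : Type u} [CommRing R] {J : Type u} [Category.{u} J] :
    (lim : (J ⥤ ModuleCat.{u} R) ⥤ ModuleCat.{u} R).Additive where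
  map_add {F G f g} := by
    apply limit.hom_ext
    intro j
    simp [Preadditive.add_comp, Preadditive.comp_add]

instance functorModuleCat_isGrothendieckAbelian {R : Type u} [CommRing R] {P : Type u}
    [PartialOrder P] : IsGrothendieckAbelian.{u} (Pᵒᵖ ⥤ ModuleCat.{u} R) :=
  IsGrothendieckAbelian.of_equivalence (sheafBotEquivalence (C := P) (ModuleCat.{u} R))

/-- `H^n(P; F)`: the `n`-th right derived functor of `lim : Fun(Pᵒᵖ, R-mod) → R-mod` at `F`. -/
def posetCohomology {R : Type u} [CommRing R] {P : Type u} [PartialOrder P]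
    (F : Pᵒᵖ ⥤ ModuleCat.{u} R) (n : ℕ) : ModuleCat.{u} R :=
  ((lim : (Pᵒᵖ ⥤ ModuleCat.{u} R) ⥤ ModuleCat.{u} R).rightDerived n).obj F

/-- Unbounded cochain complexes of `R`-modules. -/
abbrev Ch (R : Type u) [CommRing R] : Type (u + 1) := CochainComplex (ModuleCat.{u} R) ℤ

/-- `H^*(P; F) = H^*(K)` as graded `R`-modules, where `H^n(P; F) = 0` for `n < 0`. -/
def ComputesCohomology {R : Type u} [CommRing R] {P : Type u} [PartialOrder P]
    (F : Pᵒᵖ ⥤ ModuleCat.{u} R) (K : Ch R) : Prop :=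
  (∀ n : ℕ, Nonempty (posetCohomology F n ≅ K.homology (n : ℤ))) ∧
    ∀ n : ℤ, n < 0 → IsZero (K.homology n)

/-- A functor to `R`-modules, seen as a functor to complexes concentrated in degree `0`. -/
abbrev inDegreeZero {R : Type u} [CommRing R] {P : Type u} [PartialOrder P]
    (F : Pᵒᵖ ⥤ ModuleCat.{u} R) : Pᵒᵖ ⥤ Ch R :=
  F ⋙ HomologicalComplex.single (ModuleCat.{u} R) (ComplexShape.up ℤ) 0

/-! ### The Reedy-type classes of morphisms -/

/-- Cofibrations in the projective model structure on `Ch R`: the morphisms with the left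
lifting property against all degreewise surjective quasi-isomorphisms. -/
def projectiveCofibrations (R : Type u) [CommRing R] : MorphismProperty (Ch R) :=
  MorphismProperty.llp fun _ _ f => (∀ n : ℤ, Function.Surjective (f.f n)) ∧ QuasiIso f

/-- A weak equivalence followed by a fibrant object. -/
def IsFibrantReplacement {C : Type*} [Category C] [ModelCategory C] {X Y : C}
    (i : X ⟶ Y) : Prop :=
  WeakEquivalence i ∧ IsFibrant Y

/-! ### The mapping cocylinder -/

section Cocyl

variable {R : Type u} [CommRing R] {C D : Ch R} (f : C ⟶ D)

/-- The identification `D^i = D^j` if `i = j`, and zero otherwise. -/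
def degreeCast (D : Ch R) (i j : ℤ) : D.X i ⟶ D.X j :=
  if h : i = j then (D.XIsoOfEq h).hom else 0

theorem degreeCast_self (D : Ch R) (i : ℤ) : degreeCast D i i = 𝟙 _ := by
  simp [degreeCast]

theorem degreeCast_d_apply (D : Ch R) (i j k : ℤ) (hij : i + 1 = j) (hjk : j + 1 = k)
    (x : D.X i) :
    degreeCast D j (k - 1) (D.d i j x) = D.d (j - 1) (k - 1) (degreeCast D i (j - 1) x) := by
  have : D.d i j ≫ degreeCast D j (k - 1) = degreeCast D i (j - 1) ≫ D.d (j - 1) (k - 1) := by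
    subst hij hjk
    simp [degreeCast]
  exact ConcreteCategory.congr_hom this x

/-- The formula `∂(c, d, d') = (∂c, d' - f(c) - ∂d, ∂d')`, from degree `i` to degree `j`;
it vanishes unless `j = i + 1`. -/
def cocylD (i j : ℤ) :
    (C.X i × D.X (i - 1) × D.X i) →ₗ[R] (C.X j × D.X (j - 1) × D.X j) where
  toFun x :=
    (C.d i j x.1,
      degreeCast D i (j - 1) (x.2.2 - f.f i x.1) - D.d (i - 1) (j - 1) x.2.1,
      D.d i j x.2.2)
  map_add' x y := by
    refine Prod.ext (by simp) (Prod.ext ?_ (by simp))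
    simp only [Prod.fst_add, Prod.snd_add, map_add, map_sub]
    abel
  map_smul' r x := by
    refine Prod.ext (by simp) (Prod.ext ?_ (by simp))
    simp only [Prod.smul_fst, Prod.smul_snd, map_smul, map_sub, smul_sub, RingHom.id_apply]

theorem complex_d_d_apply (D : Ch R) (i j k : ℤ) (x : D.X i) : D.d j k (D.d i j x) = 0 :=
  ConcreteCategory.congr_hom (D.d_comp_d i j k) x

theorem complex_comm_apply (i j : ℤ) (x : C.X i) : f.f j (C.d i j x) = D.d i j (f.f i x) :=
  (ConcreteCategory.congr_hom (f.comm i j) x).symm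

/-- The mapping cocylinder of `f : C ⟶ D`, with `cocyl(f)^n = C^n × D^{n-1} × D^n`. -/
def cocyl : Ch R where
  X n := ModuleCat.of R (C.X n × D.X (n - 1) × D.X n)
  d i j := ModuleCat.ofHom (cocylD f i j)
  shape i j h := by
    have h' : ¬ i + 1 = j := h
    have h1 : D.d (i - 1) (j - 1) = 0 := D.shape _ _ fun h2 => h' (by
      have h3 : i - 1 + 1 = j - 1 := h2
      omega)
    have h2 : degreeCast D i (j - 1) = 0 := dif_neg (by omega)
    apply ModuleCat.hom_ext
    apply LinearMap.ext
    intro x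
    refine Prod.ext ?_ (Prod.ext ?_ ?_)
    · change C.d i j x.1 = 0
      rw [C.shape i j h]; rfl
    · change degreeCast D i (j - 1) _ - D.d (i - 1) (j - 1) x.2.1 = 0
      rw [h1, h2]; simp
    · change D.d i j x.2.2 = 0
      rw [D.shape i j h]; rfl
  d_comp_d' i j k hij hjk := by
    apply ModuleCat.hom_ext
    apply LinearMap.ext
    intro x
    refine Prod.ext (complex_d_d_apply C i j k x.1)
      (Prod.ext ?_ (complex_d_d_apply D i j k x.2.2))
    change degreeCast D j (k - 1) (D.d i j x.2.2 - f.f j (C.d i j x.1)) -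
      D.d (j - 1) (k - 1)
        (degreeCast D i (j - 1) (x.2.2 - f.f i x.1) - D.d (i - 1) (j - 1) x.2.1) = 0
    rw [complex_comm_apply, ← map_sub, degreeCast_d_apply D i j k hij hjk]
    simp only [map_sub, complex_d_d_apply]
    abel

/-- The map `c ↦ (c, 0, f(c))`. -/
def cocylι : C ⟶ cocyl f where
  f n := ModuleCat.ofHom (LinearMap.prod LinearMap.id (LinearMap.prod 0 (f.f n).hom))
  comm' i j hij := by
    apply ModuleCat.hom_ext
    apply LinearMap.ext
    intro c
    refine Prod.ext rfl (Prod.ext ?_ (complex_comm_apply f i j c).symm)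
    change degreeCast D i (j - 1) (f.f i c - f.f i c) - D.d (i - 1) (j - 1) 0 = 0
    simp

/-- The map `(c, d, d') ↦ d'`. -/
def cocylπ : cocyl f ⟶ D where
  f n := ModuleCat.ofHom (LinearMap.snd R _ _ ∘ₗ LinearMap.snd R _ _)
  comm' i j hij := rfl

theorem cocylι_comp_cocylπ : cocylι f ≫ cocylπ f = f := by
  ext n x
  rfl

end Cocyl

/-! ### The cocylinder of a functor, by well-founded recursion

For `p : P` the recursion produces the complex `RF(p)`, the map `F(p) → RF(p)` and, for `r < p`,
the map `RF(p) → RF(r)`, whose target is recorded as part of the data. -/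

section Recursion

variable {R : Type u} [CommRing R] {P : Type u} [PartialOrder P] (F : Pᵒᵖ ⥤ Ch R)

/-- The data produced by the recursion at `p`. -/
structure CocylStage (p : P) where
  X : Ch R
  ι : F.obj (op p) ⟶ X
  Y : ∀ r : P, r < p → Ch R
  m : ∀ (r : P) (h : r < p), X ⟶ Y r h

variable {F}

/-- The data at the elements of `S` fit together to a functor on `S` under `F`. -/
structure CocylCoherent {S : Set P} (v : ∀ q : S, CocylStage F q.1) : Prop where
  target : ∀ (q r : S) (h : r.1 < q.1), (v q).Y r.1 h = (v r).X
  comp : ∀ (q r s : S) (h : r.1 < q.1) (h' : s.1 < r.1),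
    ((v q).m r.1 h ≫ eqToHom (target q r h)) ≫ (v r).m s.1 h' ≫ eqToHom (target r s h') =
      (v q).m s.1 (h'.trans h) ≫ eqToHom (target q s (h'.trans h))
  nat : ∀ (q r : S) (h : r.1 < q.1),
    (v q).ι ≫ (v q).m r.1 h ≫ eqToHom (target q r h) = F.map (homOfLE h.le).op ≫ (v r).ι

namespace CocylCoherent

variable {S : Set P} {v : ∀ q : S, CocylStage F q.1} (hv : CocylCoherent v)

open Classical in
/-- The transition maps of a coherent family. -/
def trans (q r : S) (h : r.1 ≤ q.1) : (v q).X ⟶ (v r).X :=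
  if e : q.1 = r.1 then eqToHom (by rw [Subtype.ext e])
  else (v q).m r.1 (lt_of_le_of_ne h (Ne.symm e)) ≫
    eqToHom (hv.target q r _)

theorem trans_self (q : S) : hv.trans q q le_rfl = 𝟙 _ := by
  simp [trans]

theorem trans_lt (q r : S) (h : r.1 < q.1) :
    hv.trans q r h.le = (v q).m r.1 h ≫ eqToHom (hv.target q r h) := by
  have : ¬ q.1 = r.1 := h.ne'
  simp [trans, this]

theorem trans_comp (q r s : S) (h : r.1 ≤ q.1) (h' : s.1 ≤ r.1) :
    hv.trans q r h ≫ hv.trans r s h' = hv.trans q s (h'.trans h) := by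
  rcases eq_or_lt_of_le h with e | h
  · obtain rfl : r = q := Subtype.ext e
    rw [trans_self, Category.id_comp]
  rcases eq_or_lt_of_le h' with e | h'
  · obtain rfl : s = r := Subtype.ext e
    rw [trans_self, Category.comp_id]
  rw [trans_lt _ _ _ h, trans_lt _ _ _ h', trans_lt _ _ _ (h'.trans h)]
  exact hv.comp q r s h h'

/-- The functor given by a coherent family. -/
def functor : Sᵒᵖ ⥤ Ch R where
  obj q := (v q.unop).X
  map {q r} f := hv.trans q.unop r.unop (leOfHom f.unop)
  map_id q := hv.trans_self _
  map_comp {q r s} f g := (hv.trans_comp q.unop r.unop s.unop _ _).symm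

/-- The natural transformation from `F` to the functor given by a coherent family. -/
def natTrans :
    (Monotone.functor (f := fun q : S => (q : P)) fun _ _ h => h).op ⋙ F ⟶ hv.functor where
  app q := (v q.unop).ι
  naturality q r f := by
    change F.map _ ≫ (v r.unop).ι = (v q.unop).ι ≫ hv.trans q.unop r.unop (leOfHom f.unop)
    have h : r.unop.1 ≤ q.unop.1 := leOfHom f.unop
    obtain ⟨q⟩ := q
    obtain ⟨r⟩ := r
    rcases eq_or_lt_of_le h with e | h
    · obtain rfl : r = q := Subtype.ext e
      rw [trans_self, Category.comp_id]
      refine Eq.trans ?_ (Category.id_comp _)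
      congr 1
      exact F.map_id _
    · rw [trans_lt _ _ _ h, hv.nat q r h]
      rfl

end CocylCoherent

/-- The composite `F(p) → lim_{P_{<p}} F → lim_{P_{<p}} G`, for `G` and `F|_{P_{<p}} → G`
on `P_{<p}`. -/
def toLimLT (p : P) {G : (Set.Iio p)ᵒᵖ ⥤ Ch R} (η : restrictLT F p ⟶ G) :
    F.obj (op p) ⟶ limit G :=
  matchingMap F p ≫ limMap η

/-- The recursion step at `p`: the mapping cocylinder of `F(p) → lim_{P_{<p}} F → lim_{P_{<p}} RF`,
where `RF` on `P_{<p}` is given by a coherent family `v`. -/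
def cocylStep (p : P) (v : ∀ q : Set.Iio p, CocylStage F q.1) (hv : CocylCoherent v) :
    CocylStage F p where
  X := cocyl (toLimLT p hv.natTrans)
  ι := cocylι (toLimLT p hv.natTrans)
  Y r h := (v ⟨r, h⟩).X
  m r h := cocylπ (toLimLT p hv.natTrans) ≫ limit.π hv.functor (op ⟨r, h⟩)

variable (F) [FilteredPoset P]

open Classical in
/-- The stages of the recursion. The second branch is never taken, see `cocylStage_coherent`. -/
def cocylStage : ∀ p : P, CocylStage F p :=
  wellFounded_lt.fix fun p v =>
    if hv : CocylCoherent (fun q : Set.Iio p => v q.1 q.2) then cocylStep p _ hv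
    else ⟨F.obj (op p), 𝟙 _, fun r _ => F.obj (op r), fun _ h => F.map (homOfLE h.le).op⟩

theorem cocylStage_eq (p : P)
    (hv : CocylCoherent (fun q : Set.Iio p => cocylStage F q.1)) :
    cocylStage F p = cocylStep p _ hv := by
  unfold cocylStage
  rw [WellFounded.fix_eq]
  exact dif_pos hv

theorem cocylStage_X (p : P)
    (hv : CocylCoherent (fun q : Set.Iio p => cocylStage F q.1)) :
    (cocylStage F p).X = cocyl (toLimLT p hv.natTrans) :=
  congrArg CocylStage.X (cocylStage_eq F p hv)

theorem cocylStage_Y (p : P)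
    (hv : CocylCoherent (fun q : Set.Iio p => cocylStage F q.1)) (r : P) (h : r < p) :
    (cocylStage F p).Y r h = (cocylStage F r).X := by
  rw [cocylStage_eq F p hv]
  rfl

theorem cocylStage_m (p : P)
    (hv : CocylCoherent (fun q : Set.Iio p => cocylStage F q.1)) (r : P) (h : r < p) :
    (cocylStage F p).m r h ≫ eqToHom (cocylStage_Y F p hv r h) =
      eqToHom (cocylStage_X F p hv) ≫ cocylπ (toLimLT p hv.natTrans) ≫
        (show limit hv.functor ⟶ (cocylStage F r).X from limit.π hv.functor (op ⟨r, h⟩)) := by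
  have key : ∀ (s : CocylStage F p) (_ : s = cocylStep p _ hv) (e : s.Y r h = (cocylStage F r).X)
      (e' : s.X = cocyl (toLimLT p hv.natTrans)),
      s.m r h ≫ eqToHom e = eqToHom e' ≫ cocylπ (toLimLT p hv.natTrans) ≫
        (show limit hv.functor ⟶ (cocylStage F r).X from limit.π hv.functor (op ⟨r, h⟩)) := by
    rintro _ rfl e e'
    exact (Category.comp_id _).trans (Category.id_comp _).symm
  exact key _ (cocylStage_eq F p hv) _ _

theorem cocylStage_ι (p : P)
    (hv : CocylCoherent (fun q : Set.Iio p => cocylStage F q.1)) :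
    (cocylStage F p).ι ≫ eqToHom (cocylStage_X F p hv) = cocylι (toLimLT p hv.natTrans) := by
  have key : ∀ (s : CocylStage F p) (_ : s = cocylStep p _ hv)
      (e' : s.X = cocyl (toLimLT p hv.natTrans)),
      s.ι ≫ eqToHom e' = cocylι (toLimLT p hv.natTrans) := by
    rintro _ rfl e'
    exact Category.comp_id _
  exact key _ (cocylStage_eq F p hv) _

theorem cocylStage_coherent_of (S : Set P)
    (hS : ∀ q ∈ S, CocylCoherent (fun r : Set.Iio q => cocylStage F r.1)) :
    CocylCoherent (fun q : S => cocylStage F q.1) := by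
  refine ⟨fun q r h => cocylStage_Y F q.1 (hS q.1 q.2) r.1 h, ?_, ?_⟩
  · intro q r s h h'
    have hv := hS q.1 q.2
    rw [cocylStage_m F q.1 hv r.1 h, cocylStage_m F q.1 hv s.1 (h'.trans h)]
    rw [Category.assoc, Category.assoc]
    congr 2
    have w := limit.w hv.functor
      (homOfLE (show (⟨s.1, h'.trans h⟩ : Set.Iio q.1) ≤ ⟨r.1, h⟩ from h'.le)).op
    refine Eq.trans ?_ w
    exact congrArg (fun k => limit.π hv.functor (op ⟨r.1, h⟩) ≫ k)
      (hv.trans_lt ⟨r.1, h⟩ ⟨s.1, h'.trans h⟩ h').symm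
  · intro q r h
    have hv := hS q.1 q.2
    rw [cocylStage_m F q.1 hv r.1 h, ← Category.assoc, cocylStage_ι F q.1 hv, ← Category.assoc,
      cocylι_comp_cocylπ]
    refine (Category.assoc _ _ _).trans ?_
    refine (congrArg (fun k => matchingMap F q.1 ≫ k)
      (limMap_π hv.natTrans (op (⟨r.1, h⟩ : Set.Iio q.1)))).trans ?_
    refine (Category.assoc _ _ _).symm.trans ?_
    exact congrArg (fun k => k ≫ (cocylStage F r.1).ι) (limit.lift_π _ _)

theorem cocylStage_coherent (p : P) :
    CocylCoherent (fun q : Set.Iio p => cocylStage F q.1) := by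
  refine wellFounded_lt.induction (C := fun p : P =>
    CocylCoherent (fun q : Set.Iio p => cocylStage F q.1)) p fun p ih => ?_
  exact cocylStage_coherent_of F _ ih

theorem cocylStage_coherent_univ :
    CocylCoherent (fun q : (Set.univ : Set P) => cocylStage F q.1) :=
  cocylStage_coherent_of F _ fun q _ => cocylStage_coherent F q

/-- The cocylinder `RF` of a functor `F : Pᵒᵖ ⥤ Ch R`. -/
def cocylinder : Pᵒᵖ ⥤ Ch R :=
  (Monotone.functor (f := fun q : P => (⟨q, trivial⟩ : (Set.univ : Set P))) fun _ _ h => h).op ⋙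
    (cocylStage_coherent_univ F).functor

/-- The natural transformation `F → RF`. -/
def cocylinderι : F ⟶ cocylinder F :=
  Functor.whiskerLeft
    (Monotone.functor (f := fun q : P => (⟨q, trivial⟩ : (Set.univ : Set P))) fun _ _ h => h).op
    (cocylStage_coherent_univ F).natTrans

/-- The composite `F(p) → lim_{P_{<p}} F → lim_{P_{<p}} RF`. -/
def cocylinderε (p : P) : F.obj (op p) ⟶ limit (restrictLT (cocylinder F) p) :=
  toLimLT p (restrictLTMap (cocylinderι F) p)

/-- The defining recursion `RF(p) = cocyl(F(p) → lim_{P_{<p}} F → lim_{P_{<p}} RF)`. -/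
theorem cocylinder_obj (p : P) :
    (cocylinder F).obj (op p) = cocyl (cocylinderε F p) :=
  cocylStage_X F p (cocylStage_coherent F p)

/-- `RF(q < p)` is the projection `π` of the mapping cocylinder followed by the natural map of
the cone. -/
theorem cocylinder_map (p q : P) (h : q < p) :
    (cocylinder F).map (homOfLE h.le).op =
      eqToHom (cocylinder_obj F p) ≫ cocylπ (cocylinderε F p) ≫
        limit.π (restrictLT (cocylinder F) p) (op ⟨q, h⟩) :=
  ((cocylStage_coherent_univ F).trans_lt ⟨p, trivial⟩ ⟨q, trivial⟩ h).trans
    (cocylStage_m F p (cocylStage_coherent F p) q h)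

/-- At each `p`, the map `F(p) → RF(p)` is the map `i` into the mapping cocylinder. -/
theorem cocylinderι_app (p : P) :
    (cocylinderι F).app (op p) ≫ eqToHom (cocylinder_obj F p) = cocylι (cocylinderε F p) :=
  cocylStage_ι F p (cocylStage_coherent F p)

end Recursion

end

/-! The degree function makes `<` well founded, so maps, elements and primitives over `P` are built
by recursion: at `p` everything below `p` is known, and it remains to extend across the matching map
of `p`. In degree `n` an element of `lim_{P_{<p}} F` is a compatible family below `p`. A fibration
therefore lets such families extend to `p` over a given element of the target, and a fibrant object
("flasque" below) lets them extend outright.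

The central fact is `ComplexSystem.IsFlasque.exists_extension`: in a flasque system of exact
complexes, primitives prescribed compatibly below `p` extend to `p`. Consequently `K(p) →
lim_{P_{<p}} K` has exact kernel, and `lim K` is exact. Applied to the kernels of a trivial
fibration, it shows that the relative matching maps are surjective quasi-isomorphisms. Applied to
the mapping cones of a weak equivalence between flasque functors, it shows that `lim` preserves that
weak equivalence.

Model structure. Lifts are built by recursion from lifts against the relative matching maps, which
reduces both lifting axioms to complexes of modules. Both factorizations come from the small object
argument. Its trivial cells are disks on `P_{<p}` included in disks on `P_{≤p}`, and they detect
fibrations; adding sphere-to-disk inclusions placed freely at `p` detects trivial fibrations. The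
left classes obtained are pointwise cofibrations because evaluation at `p` has a right adjoint that
preserves fibrations and trivial fibrations.

Cohomology. Injective functors are flasque, so an injective resolution `I` of `F` is a flasque
replacement with `H^n(lim I) = H^n(P; F)`. Any other flasque replacement is linked to `I` by a
zigzag of weak equivalences between flasque functors. The cocylinder is flasque since its matching
maps are the surjections `π`, and `F → RF` is a weak equivalence since each `i` is a
quasi-isomorphism. Flasqueness and weak equivalences restrict to `P_{<p}`, which gives the
cohomology of `P_{<p}`. -/

noncomputable section

/-! ### Well-founded extension of compatible families -/

/-- Recursion on `p` with a choice at each stage. Families are indexed by all of `P` instead of a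
subposet, to keep the types simple; outside `S` the values may be arbitrary, which is what
`Nonempty` provides. -/
theorem exists_compatible_family {P : Type*} [PartialOrder P] [WellFoundedLT P] {X : P → Type*}
    [∀ p, Nonempty (X p)] (good : ∀ p, X p → Prop) (rel : ∀ p q, q < p → X p → X q → Prop)
    (S : LowerSet P)
    (ext : ∀ p ∈ S, ∀ x : ∀ q, X q, (∀ q < p, good q (x q)) →
      (∀ q < p, ∀ r, ∀ h : r < q, rel q r h (x q) (x r)) →
      ∃ y, good p y ∧ ∀ q, ∀ h : q < p, rel p q h y (x q)) :
    ∃ x : ∀ p, X p, ∀ p ∈ S, good p (x p) ∧ ∀ q, ∀ h : q < p, rel p q h (x p) (x q) := by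
  classical
  let step : ∀ p, (∀ q, q < p → X q) → X p := fun p v =>
    if h : ∃ y, good p y ∧ ∀ q, ∀ h : q < p, rel p q h y (v q h) then h.choose
    else Classical.arbitrary _
  let x : ∀ p, X p := wellFounded_lt.fix step
  have hx : ∀ p, x p = step p fun q _ => x q := fun p => wellFounded_lt.fix_eq step p
  refine ⟨x, fun p => ?_⟩
  induction p using WellFoundedLT.induction with
  | ind p ih =>
    intro hp
    have h : ∃ y, good p y ∧ ∀ q, ∀ h : q < p, rel p q h y (x q) :=
      ext p hp x (fun q hq => (ih q hq (S.lower hq.le hp)).1)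
        fun q hq => (ih q hq (S.lower hq.le hp)).2
    have e : x p = h.choose := by rw [hx p]; exact dif_pos h
    rw [e]
    exact h.choose_spec

/-! ### Systems of complexes of abelian groups over a poset -/

/-- A contravariant system of cochain complexes of abelian groups over a poset. -/
structure ComplexSystem (P : Type*) [PartialOrder P] where
  X : P → ℤ → Type*
  [grp : ∀ p n, AddCommGroup (X p n)]
  d : ∀ p n, X p n →+ X p (n + 1)
  res : ∀ {p q : P}, q < p → ∀ n, X p n →+ X q n
  d_d : ∀ p n x, d p (n + 1) (d p n x) = 0
  res_res : ∀ {p q r : P} (h : q < p) (h' : r < q) n x,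
    res h' n (res h n x) = res (h'.trans h) n x
  res_d : ∀ {p q : P} (h : q < p) n x, res h (n + 1) (d p n x) = d q n (res h n x)

namespace ComplexSystem

attribute [instance] ComplexSystem.grp

variable {P : Type*} [PartialOrder P] (K : ComplexSystem P)

/-- A family is compatible below `p`. -/
def CompatibleBelow (p : P) {n : ℤ} (x : ∀ q, K.X q n) : Prop :=
  ∀ q < p, ∀ r, ∀ h : r < q, K.res h n (x q) = x r

/-- Compatible families below `p` extend to `p`. -/
def IsFlasque : Prop :=
  ∀ p n (x : ∀ q, K.X q n), K.CompatibleBelow p x → ∃ y, ∀ q, ∀ h : q < p, K.res h n y = x q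

/-- All the complexes are exact. -/
def IsExact : Prop :=
  ∀ p n (z : K.X p (n + 1)), K.d p (n + 1) z = 0 → ∃ w, K.d p n w = z

variable {K}

/-- Induction on `p`: the limit over the elements below `p` is exact by the inductive hypothesis and
`K(p)` is exact, so the kernel of the surjection from `K(p)` to that limit is exact too. -/
theorem IsFlasque.exists_extension [WellFoundedLT P] (hf : K.IsFlasque) (he : K.IsExact) (p : P) :
    ∀ n (z : K.X p (n + 1)) (x : ∀ q, K.X q n), K.d p (n + 1) z = 0 → K.CompatibleBelow p x →
      (∀ q, ∀ h : q < p, K.d q n (x q) = K.res h _ z) →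
      ∃ w, K.d p n w = z ∧ ∀ q, ∀ h : q < p, K.res h n w = x q := by
  induction p using WellFoundedLT.induction with
  | ind p ih =>
    intro n z x hz hx hxz
    obtain ⟨m, rfl⟩ : ∃ m, n = m + 1 := ⟨n - 1, by omega⟩
    obtain ⟨w, hw⟩ := hf p _ x hx
    obtain ⟨v, hv⟩ := he p _ (z - K.d p _ w) (by simp [hz, K.d_d])
    -- Below `p` the restrictions of `v` are cocycles, because `d (res v) = res z - d x = 0`. By
    -- induction they have a compatible family of primitives `t`.
    obtain ⟨t, ht⟩ := exists_compatible_family (X := fun q => K.X q m)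
      (fun q y => ∀ h : q < p, K.d q m y = K.res h _ v)
      (fun q r h a b => K.res h m a = b) (LowerSet.Iio p) (by
        intro q hq y hy hyy
        have hq : q < p := hq
        obtain ⟨w, hw, hw'⟩ := ih q hq m (K.res hq _ v) y
          (by rw [← K.res_d, hv, map_sub, K.res_d, hw q hq, hxz q hq, sub_self]) (fun r hr s h => hyy r hr s h)
          (fun r hr => by rw [hy r hr (hr.trans hq), K.res_res])
        exact ⟨w, fun _ => hw, hw'⟩)
    obtain ⟨s, hs⟩ := hf p _ t fun q hq => (ht q hq).2
    -- The correction `v - d s` has differential `d v = z - d w` and vanishes below `p`, so it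
    -- repairs `d w` without changing the restrictions of `w`.
    refine ⟨w + (v - K.d p _ s), by simp [hv, K.d_d], fun q h => ?_⟩
    rw [map_add, map_sub, K.res_d, hs q h, (ht q h).1 h, hw q h, sub_self, add_zero]

theorem IsFlasque.exists_global [WellFoundedLT P] (hf : K.IsFlasque) (he : K.IsExact) (n : ℤ)
    (z : ∀ p, K.X p (n + 1)) (hz : ∀ p, K.d p (n + 1) (z p) = 0)
    (hzz : ∀ p q, ∀ h : q < p, K.res h _ (z p) = z q) :
    ∃ w : ∀ p, K.X p n, (∀ p, K.d p n (w p) = z p) ∧ ∀ p q, ∀ h : q < p, K.res h n (w p) = w q := by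
  obtain ⟨w, hw⟩ := exists_compatible_family (X := fun q => K.X q n)
      (fun q y => K.d q n y = z q) (fun q r h a b => K.res h n a = b) ⊤ (by
        intro p _ x hx hxx
        exact hf.exists_extension he p n (z p) x (hz p) hxx fun q h => by rw [hx q h, hzz])
  exact ⟨w, fun p => (hw p trivial).1, fun p => (hw p trivial).2⟩

end ComplexSystem

/-! ### Quasi-isomorphisms elementwise -/

section QuasiIso

variable {R : Type u} [CommRing R]

theorem exists_cycles_of_d_eq_zero (A : Ch R) {n : ℤ} (a : A.X n) (ha : A.d n (n + 1) a = 0) :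
    ∃ z : A.cycles n, A.iCycles n z = a := by
  have h : (ShortComplex.mk (A.iCycles n) (A.d n (n + 1)) (A.iCycles_d n _)).Exact :=
    ShortComplex.exact_of_f_is_kernel _ (A.cyclesIsKernel n (n + 1) (by simp))
  exact (ShortComplex.moduleCat_exact_iff _).1 h a ha

theorem homologyπ_eq_zero_iff (A : Ch R) {n : ℤ} (z : A.cycles (n + 1)) :
    A.homologyπ _ z = 0 ↔ ∃ a : A.X n, A.d n _ a = A.iCycles _ z := by
  have h : (ShortComplex.mk (A.toCycles n (n + 1)) (A.homologyπ _)
      (A.toCycles_comp_homologyπ _ _)).Exact :=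
    ShortComplex.exact_of_g_is_cokernel _ (A.homologyIsCokernel n (n + 1) (by simp))
  have hi : Function.Injective (A.iCycles (n + 1)) :=
    (ModuleCat.mono_iff_injective _).1 inferInstance
  have e : ∀ a, A.iCycles (n + 1) (A.toCycles n (n + 1) a) = A.d n (n + 1) a := fun a =>
    ConcreteCategory.congr_hom (A.toCycles_i n (n + 1)) a
  constructor
  · intro hz
    obtain ⟨a, ha⟩ := (ShortComplex.moduleCat_exact_iff _).1 h z hz
    exact ⟨a, by rw [← e]; exact congrArg _ ha⟩
  · rintro ⟨a, ha⟩
    obtain rfl : A.toCycles n (n + 1) a = z := hi (by rw [e, ha])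
    exact ConcreteCategory.congr_hom (A.toCycles_comp_homologyπ n (n + 1)) a

variable {A B : Ch R} (f : A ⟶ B)

/-- A morphism of complexes is a quasi-isomorphism iff its mapping cone is exact. -/
theorem isIso_homologyMap_iff :
    (∀ n, IsIso (HomologicalComplex.homologyMap f n)) ↔
      ∀ (n : ℤ) (a : A.X (n + 1 + 1)) (b : B.X (n + 1)), A.d _ (n + 1 + 1 + 1) a = 0 →
        f.f _ a = B.d _ _ b →
        ∃ (a' : A.X (n + 1)) (b' : B.X n), A.d _ _ a' = a ∧ f.f _ a' - B.d _ _ b' = b := by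
  have hπ : ∀ n z, HomologicalComplex.homologyMap f n (A.homologyπ n z) =
      B.homologyπ n (HomologicalComplex.cyclesMap f n z) := fun n z =>
    ConcreteCategory.congr_hom (HomologicalComplex.homologyπ_naturality f n) z
  have hι : ∀ n z, B.iCycles n (HomologicalComplex.cyclesMap f n z) = f.f n (A.iCycles n z) :=
    fun n z => ConcreteCategory.congr_hom (HomologicalComplex.cyclesMap_i f n) z
  have hd : ∀ (C : Ch R) (n : ℤ) z, C.d n (n + 1) (C.iCycles n z) = 0 := fun C n z =>
    ConcreteCategory.congr_hom (C.iCycles_d n (n + 1)) z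
  have hs : ∀ (C : Ch R) (n : ℤ), Function.Surjective (C.homologyπ n) := fun C n =>
    (ModuleCat.epi_iff_surjective _).1 inferInstance
  constructor
  · intro h n a b ha hab
    have h1 := (ConcreteCategory.bijective_of_isIso
      (HomologicalComplex.homologyMap f (n + 1 + 1))).1
    have h2 := (ConcreteCategory.bijective_of_isIso
      (HomologicalComplex.homologyMap f (n + 1))).2
    obtain ⟨z, rfl⟩ := exists_cycles_of_d_eq_zero A a ha
    obtain ⟨a', ha'⟩ := (homologyπ_eq_zero_iff A z).1 (h1 (by
      rw [map_zero, hπ, homologyπ_eq_zero_iff]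
      exact ⟨b, by rw [hι, hab]⟩))
    obtain ⟨y, hy⟩ := exists_cycles_of_d_eq_zero B (b - f.f _ a') (by
      rw [map_sub, ← hab, ← complex_comm_apply, ha', sub_self])
    obtain ⟨t, ht⟩ := h2 (B.homologyπ _ y)
    obtain ⟨w, rfl⟩ := hs _ _ t
    rw [hπ, ← sub_eq_zero, ← map_sub, homologyπ_eq_zero_iff] at ht
    obtain ⟨b', hb'⟩ := ht
    rw [map_sub, hι, hy] at hb'
    refine ⟨a' + A.iCycles _ w, b', ?_, ?_⟩
    · rw [map_add, hd, add_zero, ha']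
    · rw [hb', map_add]
      abel
  · intro h n
    obtain ⟨n, rfl⟩ : ∃ m, n = m + 1 := ⟨n - 1, by omega⟩
    rw [ConcreteCategory.isIso_iff_bijective]
    constructor
    -- The cone condition at index `n` governs injectivity in degree `n + 2` (the component `a`) and
    -- surjectivity in degree `n + 1` (take `a = 0`), hence a second shift here.
    · obtain ⟨n, rfl⟩ : ∃ m, n = m + 1 := ⟨n - 1, by omega⟩
      rw [injective_iff_map_eq_zero]
      intro x hx
      obtain ⟨z, rfl⟩ := hs _ _ x
      rw [hπ, homologyπ_eq_zero_iff] at hx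
      obtain ⟨b, hb⟩ := hx
      obtain ⟨a', -, ha', -⟩ := h n (A.iCycles _ z) b (hd _ _ _) (by rw [hb, hι])
      exact (homologyπ_eq_zero_iff A z).2 ⟨a', ha'⟩
    · intro y
      obtain ⟨z, rfl⟩ := hs _ _ y
      obtain ⟨a', b', ha', hb'⟩ := h n 0 (B.iCycles _ z) (by simp) (by rw [hd, map_zero])
      obtain ⟨w, rfl⟩ := exists_cycles_of_d_eq_zero A a' ha'
      refine ⟨A.homologyπ _ w, ?_⟩
      rw [hπ, ← sub_eq_zero, ← map_sub, homologyπ_eq_zero_iff]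
      exact ⟨b', by rw [map_sub, hι, ← hb']; abel⟩

/-- A surjective quasi-isomorphism has an exact kernel. -/
theorem exists_d_eq_of_map_eq_zero (hs : ∀ n, Function.Surjective (f.f n))
    (hf : ∀ n, IsIso (HomologicalComplex.homologyMap f n)) (n : ℤ) (a : A.X (n + 1))
    (ha : A.d _ (n + 1 + 1) a = 0) (hfa : f.f _ a = 0) : ∃ a', A.d n _ a' = a ∧ f.f _ a' = 0 := by
  obtain ⟨n, rfl⟩ : ∃ m, n = m + 1 := ⟨n - 1, by omega⟩
  obtain ⟨a', b', h1, h2⟩ := (isIso_homologyMap_iff f).1 hf n a 0 ha (by rw [hfa, map_zero])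
  obtain ⟨c, rfl⟩ := hs _ b'
  refine ⟨a' - A.d _ _ c, ?_, ?_⟩
  -- Exactness of the cone at `(a, 0)` gives `d a' = a` and `f a' = d b'`; subtracting the
  -- differential of a lift `c` of `b'` moves `a'` into the kernel.
  · rw [map_sub, complex_d_d_apply, sub_zero, h1]
  · rw [map_sub, complex_comm_apply, h2]

/-- Converse of `exists_d_eq_of_map_eq_zero`. For a cone cocycle `(a, b)` and a lift `c` of `b`, the
difference `a - d c` is a cocycle of the kernel, hence a boundary there. -/
theorem isIso_homologyMap_of_surjective (hs : ∀ n, Function.Surjective (f.f n))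
    (h : ∀ n (a : A.X (n + 1)), A.d _ (n + 1 + 1) a = 0 → f.f _ a = 0 →
      ∃ a', A.d n _ a' = a ∧ f.f _ a' = 0) (n : ℤ) :
    IsIso (HomologicalComplex.homologyMap f n) := by
  revert n
  rw [isIso_homologyMap_iff]
  intro n a b ha hab
  obtain ⟨c, rfl⟩ := hs _ b
  obtain ⟨k, hk, hk'⟩ := h _ (a - A.d _ _ c) (by rw [map_sub, ha, complex_d_d_apply, sub_zero])
    (by rw [map_sub, complex_comm_apply, hab, sub_self])
  exact ⟨c + k, 0, by rw [map_add, hk]; abel, by rw [map_add, hk', map_zero]; abel⟩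

end QuasiIso

/-! ### Elements of limits of complexes -/

section Limits

variable {R : Type u} [CommRing R]

/-- The underlying set in degree `n` of a complex. -/
abbrev evalForget (R : Type u) [CommRing R] (n : ℤ) : Ch R ⥤ Type u :=
  HomologicalComplex.eval (ModuleCat.{u} R) (ComplexShape.up ℤ) n ⋙ forget _

/-- Evaluation in degree `n` followed by the forgetful functor preserves limits, so elements of a
limit are sections. -/
theorem limit_complex_ext {J : Type u} [Category.{u} J] {G : J ⥤ Ch R} {n : ℤ}
    {x y : (limit G).X n} (h : ∀ j, (limit.π G j).f n x = (limit.π G j).f n y) : x = y :=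
  (Types.isLimitEquivSections
    (isLimitOfPreserves (evalForget R n) (limit.isLimit G))).injective (Subtype.ext (funext h))

theorem limit_complex_exists {J : Type u} [Category.{u} J] (G : J ⥤ Ch R) {n : ℤ}
    (x : ∀ j, (G.obj j).X n) (hx : ∀ j k (f : j ⟶ k), (G.map f).f n (x j) = x k) :
    ∃ y : (limit G).X n, ∀ j, (limit.π G j).f n y = x j := by
  let e := Types.isLimitEquivSections (isLimitOfPreserves (evalForget R n) (limit.isLimit G))
  refine ⟨e.symm ⟨x, fun f => hx _ _ f⟩, fun j => ?_⟩
  exact congrFun (congrArg Subtype.val (e.apply_symm_apply ⟨x, fun f => hx _ _ f⟩)) j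

variable {A B C : Ch R} (f : A ⟶ C) (g : B ⟶ C)

theorem isPullback_evalForget (n : ℤ) : IsPullback ((evalForget R n).map (pullback.fst f g))
    ((evalForget R n).map (pullback.snd f g)) ((evalForget R n).map f) ((evalForget R n).map g) :=
  (IsPullback.of_hasPullback f g).map (evalForget R n)

variable {f g} in
theorem pullback_complex_ext {n : ℤ} {x y : (pullback f g).X n}
    (h1 : (pullback.fst f g).f n x = (pullback.fst f g).f n y)
    (h2 : (pullback.snd f g).f n x = (pullback.snd f g).f n y) : x = y :=
  Types.ext_of_isPullback (isPullback_evalForget f g n) h1 h2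

theorem pullback_complex_exists {n : ℤ} (a : A.X n) (b : B.X n) (h : f.f n a = g.f n b) :
    ∃ x : (pullback f g).X n, (pullback.fst f g).f n x = a ∧ (pullback.snd f g).f n x = b :=
  Types.exists_of_isPullback (isPullback_evalForget f g n) a b h

end Limits

/-! ### Contravariant functors on a poset, elementwise -/

section Res

variable {R : Type u} [CommRing R] {P : Type u} [PartialOrder P]

/-- The restriction map `F(p)^n → F(q)^n` for `q ≤ p`. -/
def res (F : Pᵒᵖ ⥤ Ch R) {p q : P} (h : q ≤ p) (n : ℤ) :
    (F.obj (op p)).X n →ₗ[R] (F.obj (op q)).X n :=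
  ((F.map (homOfLE h).op).f n).hom

variable (F G : Pᵒᵖ ⥤ Ch R)

theorem res_refl (p : P) (n : ℤ) (x : (F.obj (op p)).X n) : res F le_rfl n x = x := by
  have : F.map (homOfLE (le_refl p)).op = 𝟙 _ := F.map_id (op p)
  rw [res, this]; rfl

theorem res_res {p q r : P} (h : q ≤ p) (h' : r ≤ q) (n : ℤ) (x : (F.obj (op p)).X n) :
    res F h' n (res F h n x) = res F (h'.trans h) n x := by
  have : F.map (homOfLE (h'.trans h)).op = F.map (homOfLE h).op ≫ F.map (homOfLE h').op :=
    F.map_comp (homOfLE h).op (homOfLE h').op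
  rw [res, res, res, this]; rfl

theorem res_d {p q : P} (h : q ≤ p) (n m : ℤ) (x : (F.obj (op p)).X n) :
    res F h m ((F.obj (op p)).d n m x) = (F.obj (op q)).d n m (res F h n x) :=
  complex_comm_apply _ _ _ _

variable {F G} (η : F ⟶ G)

theorem res_app {p q : P} (h : q ≤ p) (n : ℤ) (x : (F.obj (op p)).X n) :
    res G h n ((η.app (op p)).f n x) = (η.app (op q)).f n (res F h n x) := by
  have := η.naturality (homOfLE h).op
  exact (ConcreteCategory.congr_hom (HomologicalComplex.congr_hom this n) x).symm

/-- A family is compatible below `p`. -/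
def CompatibleBelow (F : Pᵒᵖ ⥤ Ch R) (p : P) {n : ℤ} (x : ∀ q, (F.obj (op q)).X n) : Prop :=
  ∀ q < p, ∀ r, ∀ h : r < q, res F h.le n (x q) = x r

/-- The relative matching maps are degreewise surjective, elementwise. -/
def IsMatchingSurjective (η : F ⟶ G) : Prop :=
  ∀ p n (x : ∀ q, (F.obj (op q)).X n) (y : (G.obj (op p)).X n), CompatibleBelow F p x →
    (∀ q, ∀ h : q < p, (η.app (op q)).f n (x q) = res G h.le n y) →
    ∃ z, (η.app (op p)).f n z = y ∧ ∀ q, ∀ h : q < p, res F h.le n z = x q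

/-- The absolute matching maps are degreewise surjective, elementwise. -/
def IsFlasque (F : Pᵒᵖ ⥤ Ch R) : Prop :=
  ∀ p n (x : ∀ q, (F.obj (op q)).X n), CompatibleBelow F p x →
    ∃ z, ∀ q, ∀ h : q < p, res F h.le n z = x q

/-- The projection `(lim_{P_{<p}} F)^n → F(q)^n` for `q < p`. -/
def limProj (F : Pᵒᵖ ⥤ Ch R) (p : P) {q : P} (h : q < p) (n : ℤ) :
    (limit (restrictLT F p)).X n →ₗ[R] (F.obj (op q)).X n :=
  ((limit.π (restrictLT F p) (op (⟨q, h⟩ : Set.Iio p))).f n).hom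

theorem limProj_ext (p : P) {n : ℤ} {x y : (limit (restrictLT F p)).X n}
    (h : ∀ q, ∀ h : q < p, limProj F p h n x = limProj F p h n y) : x = y :=
  limit_complex_ext fun q => h q.unop.1 q.unop.2

theorem matchingMap_π (p q : P) (h : q < p) (n : ℤ) (x : (F.obj (op p)).X n) :
    limProj F p h n ((matchingMap F p).f n x) = res F h.le n x := by
  have : matchingMap F p ≫ limit.π (restrictLT F p) (op ⟨q, h⟩) = F.map (homOfLE h.le).op :=
    limit.lift_π _ _
  exact ConcreteCategory.congr_hom (HomologicalComplex.congr_hom this n) x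

theorem limit_restrictLT_compatible (p : P) {n : ℤ} (x : (limit (restrictLT F p)).X n) {q r : P}
    (h : q < p) (h' : r < q) :
    res F h'.le n (limProj F p h n x) =
      limProj F p (h'.trans h) n x := by
  have := limit.w (restrictLT F p)
    (homOfLE (show (⟨r, h'.trans h⟩ : Set.Iio p) ≤ ⟨q, h⟩ from h'.le)).op
  exact ConcreteCategory.congr_hom (HomologicalComplex.congr_hom this n) x

theorem limit_restrictLT_family (p : P) {n : ℤ} (x : (limit (restrictLT F p)).X n) :
    ∃ y : ∀ q, (F.obj (op q)).X n, CompatibleBelow F p y ∧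
      ∀ q, ∀ h : q < p, limProj F p h n x = y q := by
  classical
  refine ⟨fun q => if h : q < p then limProj F p h n x else 0,
    fun q hq r hr => ?_, fun q h => by simp only [dif_pos h]⟩
  dsimp only
  rw [dif_pos hq, dif_pos (hr.trans hq), limit_restrictLT_compatible p x hq hr]

theorem limit_restrictLT_exists (p : P) {n : ℤ} (y : ∀ q, (F.obj (op q)).X n)
    (hy : CompatibleBelow F p y) : ∃ x : (limit (restrictLT F p)).X n,
      ∀ q, ∀ h : q < p, limProj F p h n x = y q := by
  obtain ⟨x, hx⟩ := limit_complex_exists (restrictLT F p) (fun q => y q.unop.1) (by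
    rintro ⟨q, hq⟩ ⟨r, hr⟩ f
    have h : r ≤ q := leOfHom f.unop
    rcases h.eq_or_lt with rfl | h
    · exact res_refl F _ n _
    · exact hy q hq r h)
  exact ⟨x, fun q h => hx (op ⟨q, h⟩)⟩

theorem limMap_restrictLTMap_π (p q : P) (h : q < p) (n : ℤ) (x : (limit (restrictLT F p)).X n) :
    limProj G p h n ((limMap (restrictLTMap η p)).f n x) =
      (η.app (op q)).f n (limProj F p h n x) :=
  ConcreteCategory.congr_hom (HomologicalComplex.congr_hom
    (limMap_π (restrictLTMap η p) (op ⟨q, h⟩)) n) x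

theorem matchingMap_surjective_iff :
    (∀ p n, Function.Surjective ((matchingMap F p).f n)) ↔ IsFlasque F := by
  constructor
  · intro h p n x hx
    obtain ⟨y, hy⟩ := limit_restrictLT_exists p x hx
    obtain ⟨z, rfl⟩ := h p n y
    exact ⟨z, fun q hq => by rw [← hy q hq, matchingMap_π]⟩
  · intro h p n y
    obtain ⟨x, hx, hxy⟩ := limit_restrictLT_family p y
    obtain ⟨z, hz⟩ := h p n x hx
    refine ⟨z, limProj_ext p ?_⟩
    intro q hq
    rw [matchingMap_π, hxy]
    exact hz q hq

theorem relativeMatchingMap_comp_fst (p : P) :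
    relativeMatchingMap η p ≫ pullback.fst _ _ = matchingMap F p :=
  pullback.lift_fst _ _ _

theorem relativeMatchingMap_comp_snd (p : P) :
    relativeMatchingMap η p ≫ pullback.snd _ _ = η.app (op p) :=
  pullback.lift_snd _ _ _

theorem relativeMatchingMap_fst (p : P) (n : ℤ) (x : (F.obj (op p)).X n) :
    (pullback.fst (limMap (restrictLTMap η p)) (matchingMap G p)).f n
      ((relativeMatchingMap η p).f n x) = (matchingMap F p).f n x :=
  ConcreteCategory.congr_hom
    (HomologicalComplex.congr_hom (relativeMatchingMap_comp_fst η p) n) x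

theorem relativeMatchingMap_snd (p : P) (n : ℤ) (x : (F.obj (op p)).X n) :
    (pullback.snd (limMap (restrictLTMap η p)) (matchingMap G p)).f n
      ((relativeMatchingMap η p).f n x) = (η.app (op p)).f n x :=
  ConcreteCategory.congr_hom
    (HomologicalComplex.congr_hom (relativeMatchingMap_comp_snd η p) n) x

theorem pullback_matching_condition (p : P) (n : ℤ)
    (x : (pullback (limMap (restrictLTMap η p)) (matchingMap G p)).X n) :
    (limMap (restrictLTMap η p)).f n ((pullback.fst _ _ : pullback _ (matchingMap G p) ⟶ _).f n x) =
      (matchingMap G p).f n ((pullback.snd (limMap (restrictLTMap η p)) _).f n x) :=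
  ConcreteCategory.congr_hom (HomologicalComplex.congr_hom pullback.condition n) x

theorem relativeMatchingMap_surjective_iff :
    (∀ p n, Function.Surjective ((relativeMatchingMap η p).f n)) ↔ IsMatchingSurjective η := by
  constructor
  · intro h p n x y hx hxy
    obtain ⟨t, ht⟩ := limit_restrictLT_exists p x hx
    obtain ⟨s, hs1, hs2⟩ := pullback_complex_exists (limMap (restrictLTMap η p)) (matchingMap G p)
      t y (by
        apply limProj_ext
        intro q hq
        rw [matchingMap_π, limMap_restrictLTMap_π, ht]
        exact hxy q hq)
    obtain ⟨z, rfl⟩ := h p n s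
    refine ⟨z, by rw [← hs2, relativeMatchingMap_snd], fun q hq => ?_⟩
    rw [← ht q hq, ← hs1, relativeMatchingMap_fst, matchingMap_π]
  · intro h p n s
    obtain ⟨x, hx, hxs⟩ := limit_restrictLT_family p ((pullback.fst _ _ : pullback
      (limMap (restrictLTMap η p)) (matchingMap G p) ⟶ _).f n s)
    obtain ⟨z, hz, hz'⟩ := h p n x
      ((pullback.snd (limMap (restrictLTMap η p)) (matchingMap G p)).f n s) hx (by
        intro q hq
        rw [← matchingMap_π p q hq, ← pullback_matching_condition, limMap_restrictLTMap_π, hxs q hq])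
    refine ⟨z, pullback_complex_ext ?_ ?_⟩
    · rw [relativeMatchingMap_fst]
      apply limProj_ext
      intro q hq
      rw [matchingMap_π, hxs]
      exact hz' q hq
    · rw [relativeMatchingMap_snd, hz]

theorem relativeMatchingMap_eq_zero_iff (p : P) (n : ℤ) (x : (F.obj (op p)).X n) :
    (relativeMatchingMap η p).f n x = 0 ↔
      (η.app (op p)).f n x = 0 ∧ ∀ q, ∀ h : q < p, res F h.le n x = 0 := by
  constructor
  · intro h
    refine ⟨by rw [← relativeMatchingMap_snd, h, map_zero], fun q hq => ?_⟩
    rw [← matchingMap_π p q hq, ← relativeMatchingMap_fst η, h, map_zero, map_zero]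
  · rintro ⟨h1, h2⟩
    refine pullback_complex_ext ?_ ?_
    · rw [relativeMatchingMap_fst, map_zero]
      apply limProj_ext
      intro q hq
      rw [matchingMap_π, map_zero]
      exact h2 q hq
    · rw [relativeMatchingMap_snd, h1, map_zero]

end Res

/-! ### Fibrations and weak equivalences -/

section Systems

variable {R : Type u} [CommRing R] {P : Type u} [PartialOrder P] {F G : Pᵒᵖ ⥤ Ch R} (η : F ⟶ G)

/-- The weak equivalences: pointwise quasi-isomorphisms. -/
def IsPointwiseQuasiIso (η : F ⟶ G) : Prop :=
  ∀ p n, IsIso (HomologicalComplex.homologyMap (η.app (op p)) n)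

/-- The kernels of a natural transformation. -/
def kernelSystem : ComplexSystem P where
  X p n := LinearMap.ker ((η.app (op p)).f n).hom
  d p n := (((F.obj (op p)).d n (n + 1)).hom.restrict fun x (hx : (η.app (op p)).f n x = 0) => by
    change (η.app (op p)).f (n + 1) ((F.obj (op p)).d n (n + 1) x) = 0
    rw [complex_comm_apply, hx, map_zero]).toAddMonoidHom
  res {p q} h n := ((res F h.le n).restrict fun x (hx : (η.app (op p)).f n x = 0) => by
    change (η.app (op q)).f n (res F h.le n x) = 0
    rw [← res_app, hx, map_zero]).toAddMonoidHom
  d_d p n x := Subtype.ext (complex_d_d_apply _ _ _ _ _)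
  res_res h h' n x := Subtype.ext (res_res F h.le h'.le n x.1)
  res_d h n x := Subtype.ext (res_d F h.le n (n + 1) x.1)

/-- The mapping cones of a natural transformation. -/
def coneSystem : ComplexSystem P where
  X p n := (F.obj (op p)).X (n + 1) × (G.obj (op p)).X n
  d p n := ((((F.obj (op p)).d (n + 1) (n + 1 + 1)).hom ∘ₗ LinearMap.fst R _ _).prod
    (((η.app (op p)).f (n + 1)).hom ∘ₗ LinearMap.fst R _ _ -
      ((G.obj (op p)).d n (n + 1)).hom ∘ₗ LinearMap.snd R _ _)).toAddMonoidHom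
  res {p q} h n := ((res F h.le (n + 1)).prodMap (res G h.le n)).toAddMonoidHom
  d_d p n x := by
    refine Prod.ext (complex_d_d_apply _ _ _ _ _) ?_
    change (η.app (op p)).f _ ((F.obj (op p)).d _ _ x.1) -
      (G.obj (op p)).d _ _ ((η.app (op p)).f _ x.1 - (G.obj (op p)).d _ _ x.2) = 0
    rw [map_sub, complex_d_d_apply, sub_zero, complex_comm_apply, sub_self]
  res_res h h' n x := Prod.ext (res_res F h.le h'.le _ x.1) (res_res G h.le h'.le n x.2)
  res_d {p q} h n x := by
    refine Prod.ext (res_d F h.le _ _ x.1) ?_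
    change res G h.le _ ((η.app (op p)).f _ x.1 - (G.obj (op p)).d _ _ x.2) =
      (η.app (op q)).f _ (res F h.le _ x.1) - (G.obj (op q)).d _ _ (res G h.le _ x.2)
    rw [map_sub, res_app, res_d]

variable {η}

/-- Compatible lifts of the restrictions of `y` are chosen recursively below `p`; one more extension
yields a lift of `y` itself. -/
theorem IsMatchingSurjective.surjective [WellFoundedLT P] (h : IsMatchingSurjective η) (p : P)
    (n : ℤ) : Function.Surjective ((η.app (op p)).f n) := by
  intro y
  obtain ⟨x, hx⟩ := exists_compatible_family (X := fun q => (F.obj (op q)).X n)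
    (fun q x => ∀ hq : q < p, (η.app (op q)).f n x = res G hq.le n y)
    (fun q r h x x' => res F h.le n x = x') (LowerSet.Iio p) (by
      intro q hq x hx hxx
      have hq : q < p := hq
      obtain ⟨z, hz, hz'⟩ := h q n x (res G hq.le n y) hxx
        (fun r hr => by rw [hx r hr (hr.trans hq), res_res])
      exact ⟨z, fun _ => hz, hz'⟩)
  obtain ⟨z, hz, -⟩ := h p n x y (fun q hq => (hx q hq).2) fun q hq => (hx q hq).1 hq
  exact ⟨z, hz⟩

theorem IsMatchingSurjective.isFlasque_kernelSystem (h : IsMatchingSurjective η) :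
    (kernelSystem η).IsFlasque := by
  intro p n x hx
  obtain ⟨z, hz, hz'⟩ := h p n (fun q => (x q).1) 0
    (fun q hq r hr => congrArg Subtype.val (hx q hq r hr))
    (fun q hq => by rw [map_zero]; exact (x q).2)
  exact ⟨⟨z, hz⟩, fun q hq => Subtype.ext (hz' q hq)⟩

theorem IsMatchingSurjective.isExact_kernelSystem [WellFoundedLT P] (h : IsMatchingSurjective η)
    (hη : IsPointwiseQuasiIso η) : (kernelSystem η).IsExact := by
  rintro p n ⟨z, hz⟩ hdz
  obtain ⟨w, hw, hw'⟩ := exists_d_eq_of_map_eq_zero _ (h.surjective p) (hη p) n z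
    (congrArg Subtype.val hdz) hz
  exact ⟨⟨w, hw'⟩, Subtype.ext hw⟩

/-- The kernel of the relative matching map consists of the elements of `kernelSystem η` at `p` that
vanish below `p`. It is exact by `exists_extension` with the zero family prescribed. -/
theorem IsMatchingSurjective.isIso_homologyMap_relativeMatchingMap [WellFoundedLT P]
    (h : IsMatchingSurjective η) (hη : IsPointwiseQuasiIso η) (p : P) (n : ℤ) :
    IsIso (HomologicalComplex.homologyMap (relativeMatchingMap η p) n) := by
  refine isIso_homologyMap_of_surjective _ ((relativeMatchingMap_surjective_iff η).2 h p) ?_ n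
  intro n a ha hfa
  rw [relativeMatchingMap_eq_zero_iff] at hfa
  obtain ⟨⟨w, hw⟩, h1, h2⟩ := h.isFlasque_kernelSystem.exists_extension
    (h.isExact_kernelSystem hη) p n ⟨a, hfa.1⟩ (fun _ => 0) (Subtype.ext ha)
    (fun _ _ _ _ => map_zero _) (fun q hq => (map_zero _).trans (Subtype.ext (hfa.2 q hq).symm))
  refine ⟨w, congrArg Subtype.val h1, ?_⟩
  rw [relativeMatchingMap_eq_zero_iff]
  exact ⟨hw, fun q hq => congrArg Subtype.val (h2 q hq)⟩

theorem isFlasque_coneSystem (hF : IsFlasque F) (hG : IsFlasque G) :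
    (coneSystem η).IsFlasque := by
  intro p n x hx
  obtain ⟨a, ha⟩ := hF p _ (fun q => (x q).1) fun q hq r hr => congrArg Prod.fst (hx q hq r hr)
  obtain ⟨b, hb⟩ := hG p _ (fun q => (x q).2) fun q hq r hr => congrArg Prod.snd (hx q hq r hr)
  exact ⟨(a, b), fun q hq => Prod.ext (ha q hq) (hb q hq)⟩

theorem isExact_coneSystem (hη : IsPointwiseQuasiIso η) : (coneSystem η).IsExact := by
  rintro p n ⟨a, b⟩ hz
  obtain ⟨a', b', h1, h2⟩ := (isIso_homologyMap_iff _).1 (hη p) n a b (congrArg Prod.fst hz)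
    (sub_eq_zero.1 (congrArg Prod.snd hz))
  exact ⟨(a', b'), Prod.ext h1 h2⟩

end Systems

/-! ### Limits over the whole poset and weak equivalences -/

section LimitQuasiIso

variable {R : Type u} [CommRing R] {P : Type u} [PartialOrder P] {F G : Pᵒᵖ ⥤ Ch R}

/-- The projection `(lim F)^n → F(p)^n`. -/
def globalProj (F : Pᵒᵖ ⥤ Ch R) (p : P) (n : ℤ) : (limit F).X n →ₗ[R] (F.obj (op p)).X n :=
  ((limit.π F (op p)).f n).hom

theorem globalProj_ext {n : ℤ} {x y : (limit F).X n}
    (h : ∀ p, globalProj F p n x = globalProj F p n y) : x = y :=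
  limit_complex_ext fun q => h q.unop

theorem globalProj_d (p : P) (n m : ℤ) (x : (limit F).X n) :
    globalProj F p m ((limit F).d n m x) = (F.obj (op p)).d n m (globalProj F p n x) :=
  complex_comm_apply _ _ _ _

theorem res_globalProj {p q : P} (h : q ≤ p) (n : ℤ) (x : (limit F).X n) :
    res F h n (globalProj F p n x) = globalProj F q n x :=
  ConcreteCategory.congr_hom (HomologicalComplex.congr_hom (limit.w F (homOfLE h).op) n) x

theorem globalProj_limMap (η : F ⟶ G) (p : P) (n : ℤ) (x : (limit F).X n) :
    globalProj G p n ((limMap η).f n x) = (η.app (op p)).f n (globalProj F p n x) :=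
  ConcreteCategory.congr_hom (HomologicalComplex.congr_hom (limMap_π η (op p)) n) x

theorem globalProj_exists {n : ℤ} (x : ∀ p, (F.obj (op p)).X n)
    (hx : ∀ p q, ∀ h : q < p, res F h.le n (x p) = x q) :
    ∃ y : (limit F).X n, ∀ p, globalProj F p n y = x p := by
  obtain ⟨y, hy⟩ := limit_complex_exists F (fun p => x p.unop) (by
    rintro ⟨q⟩ ⟨r⟩ f
    have h : r ≤ q := leOfHom f.unop
    rcases h.eq_or_lt with rfl | h
    · exact res_refl F _ n _
    · exact hx q r h)
  exact ⟨y, fun p => hy (op p)⟩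

/-- Limits preserve weak equivalences between fibrant objects. -/
theorem isIso_homologyMap_limMap [WellFoundedLT P] (η : F ⟶ G) (hF : IsFlasque F)
    (hG : IsFlasque G) (hη : IsPointwiseQuasiIso η) :
    ∀ n, IsIso (HomologicalComplex.homologyMap (limMap η) n) := by
  rw [isIso_homologyMap_iff]
  intro n a b ha hab
  -- The cone of `limMap η` is the limit of the pointwise cones, which form a flasque exact system.
  obtain ⟨w, hw, hw'⟩ := (isFlasque_coneSystem (η := η) hF hG).exists_global (isExact_coneSystem hη)
    n (fun p => (globalProj F p _ a, globalProj G p _ b))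
    (fun p => Prod.ext (by
      change (F.obj (op p)).d _ _ (globalProj F p _ a) = 0
      rw [← globalProj_d, ha, map_zero]) (by
      change (η.app (op p)).f _ (globalProj F p _ a) -
        (G.obj (op p)).d _ _ (globalProj G p _ b) = 0
      rw [← globalProj_d, ← globalProj_limMap, hab, sub_self]))
    (fun p q h => Prod.ext (res_globalProj h.le _ a) (res_globalProj h.le _ b))
  obtain ⟨a', ha'⟩ := globalProj_exists (F := F) (fun p => (w p).1)
    fun p q h => congrArg Prod.fst (hw' p q h)
  obtain ⟨b', hb'⟩ := globalProj_exists (F := G) (fun p => (w p).2)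
    fun p q h => congrArg Prod.snd (hw' p q h)
  refine ⟨a', b', globalProj_ext fun p => ?_, globalProj_ext fun p => ?_⟩
  · rw [globalProj_d, ha']
    exact congrArg Prod.fst (hw p)
  · rw [map_sub, globalProj_d, globalProj_limMap, ha', hb']
    exact congrArg Prod.snd (hw p)

end LimitQuasiIso

/-! ### Lifting -/

section Lifting

variable {R : Type u} [CommRing R] {P : Type u} [PartialOrder P] [WellFoundedLT P]
  {A B F G : Pᵒᵖ ⥤ Ch R}

/-- Lifts already chosen below `p` assemble to `B(p) → lim_{P_{<p}} F`. Together with `B(p) → G(p)`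
this is a map to the pullback, and lifting it through the relative matching map yields a lift at `p`
compatible with the earlier ones. -/
theorem hasLiftingProperty_of_relativeMatchingMap (i : A ⟶ B) (η : F ⟶ G)
    (h : ∀ p, HasLiftingProperty (i.app (op p)) (relativeMatchingMap η p)) :
    HasLiftingProperty i η where
  sq_hasLift {t b} sq := by
    obtain ⟨l, hl⟩ := exists_compatible_family (X := fun p : P => B.obj (op p) ⟶ F.obj (op p))
      (fun p l => i.app (op p) ≫ l = t.app (op p) ∧ l ≫ η.app (op p) = b.app (op p))
      (fun p q h l l' => l ≫ F.map (homOfLE h.le).op = B.map (homOfLE h.le).op ≫ l') ⊤ (by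
        intro p _ x hx hxx
        let c : Cone (restrictLT F p) :=
          { pt := B.obj (op p)
            π :=
              { app := fun q => B.map (homOfLE q.unop.2.le).op ≫ x q.unop.1
                naturality := by
                  rintro ⟨q, hq⟩ ⟨r, hr⟩ f
                  have h : r ≤ q := leOfHom f.unop
                  refine (Category.id_comp _).trans ?_
                  change B.map (homOfLE (le_of_lt hr)).op ≫ x r =
                    (B.map (homOfLE (le_of_lt hq)).op ≫ x q) ≫ F.map (homOfLE h).op
                  rcases h.eq_or_lt with rfl | h
                  · have : F.map (homOfLE (le_refl r)).op = 𝟙 _ := F.map_id _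
                    rw [this, Category.comp_id]
                  · rw [Category.assoc, hxx q hq r h, ← Category.assoc, ← B.map_comp]
                    rfl } }
        have hc : limit.lift (restrictLT F p) c ≫ limMap (restrictLTMap η p) =
            b.app (op p) ≫ matchingMap G p := by
          apply limit.hom_ext
          rintro ⟨q, hq⟩
          rw [Category.assoc, Category.assoc, limMap_π, matchingMap, limit.lift_π,
            limit.lift_π_assoc]
          change (B.map (homOfLE (le_of_lt hq)).op ≫ x q) ≫ η.app (op q) =
            b.app (op p) ≫ G.map (homOfLE (le_of_lt hq)).op
          rw [Category.assoc, (hx q hq).2, b.naturality]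
        have sq' : CommSq (t.app (op p)) (i.app (op p)) (relativeMatchingMap η p)
            (pullback.lift _ _ hc) := ⟨by
          apply pullback.hom_ext
          · rw [Category.assoc, Category.assoc, relativeMatchingMap_comp_fst,
              pullback.lift_fst]
            apply limit.hom_ext
            rintro ⟨q, hq⟩
            rw [Category.assoc, Category.assoc, matchingMap, limit.lift_π, limit.lift_π]
            change t.app (op p) ≫ F.map (homOfLE (le_of_lt hq)).op =
              i.app (op p) ≫ B.map (homOfLE (le_of_lt hq)).op ≫ x q
            rw [← i.naturality_assoc, (hx q hq).1, t.naturality]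
          · rw [Category.assoc, Category.assoc, relativeMatchingMap_comp_snd,
              pullback.lift_snd]
            exact NatTrans.congr_app sq.w (op p)⟩
        have := h p
        refine ⟨sq'.lift, ⟨sq'.fac_left, ?_⟩, fun q hq => ?_⟩
        · have := sq'.fac_right =≫ pullback.snd _ _
          rwa [Category.assoc, relativeMatchingMap_comp_snd, pullback.lift_snd] at this
        · have h0 := sq'.fac_right =≫ pullback.fst _ _
          rw [Category.assoc, relativeMatchingMap_comp_fst, pullback.lift_fst] at h0
          have e : matchingMap F p ≫ limit.π (restrictLT F p) (op (⟨q, hq⟩ : Set.Iio p)) =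
              F.map (homOfLE (le_of_lt hq)).op := limit.lift_π _ _
          exact (congrArg (sq'.lift ≫ ·) e).symm.trans ((Category.assoc _ _ _).symm.trans
            ((h0 =≫ limit.π (restrictLT F p) (op (⟨q, hq⟩ : Set.Iio p))).trans
              (limit.lift_π _ _))))
    refine ⟨⟨⟨{ app := fun p => l p.unop, naturality := ?_ }, ?_, ?_⟩⟩⟩
    · rintro ⟨p⟩ ⟨q⟩ f
      have h : q ≤ p := leOfHom f.unop
      rcases h.eq_or_lt with rfl | h
      · obtain rfl : f = 𝟙 _ := Subsingleton.elim _ _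
        rw [B.map_id, F.map_id, Category.comp_id, Category.id_comp]
      · exact ((hl p trivial).2 q h).symm
    · ext1
      ext1 p
      exact (hl p.unop trivial).1.1
    · ext1
      ext1 p
      exact (hl p.unop trivial).1.2

end Lifting

/-! ### Lifting properties for complexes of modules -/

section Cocyl

variable {R : Type u} [CommRing R]

theorem degreeCast_degreeCast (D : Ch R) {i j : ℤ} (h : i = j) (x : D.X i) :
    degreeCast D j i (degreeCast D i j x) = x := by
  subst h
  simp [degreeCast_self]

theorem d_degreeCast (D : Ch R) {i i' j j' : ℤ} (hi : i = i') (hj : j = j') (x : D.X i) :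
    D.d i' j' (degreeCast D i i' x) = degreeCast D j j' (D.d i j x) := by
  subst hi hj
  simp [degreeCast_self]

variable {C D : Ch R} (f : C ⟶ D)

theorem isIso_homologyMap_cocylι (n : ℤ) :
    IsIso (HomologicalComplex.homologyMap (cocylι f) n) := by
  revert n
  rw [isIso_homologyMap_iff]
  rintro n a ⟨c, d, d'⟩ ha hab
  have h1 : a = C.d _ _ c := congrArg Prod.fst hab
  have h2 : 0 = degreeCast D (n + 1) (n + 1 + 1 - 1) (d' - f.f _ c) -
    D.d (n + 1 - 1) (n + 1 + 1 - 1) d := congrArg (fun x => x.2.1) hab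
  have h3 : D.d n (n + 1) (degreeCast D (n + 1 - 1) n d) = d' - f.f _ c := by
    rw [d_degreeCast D (by omega) (show n + 1 + 1 - 1 = n + 1 by omega), ← sub_eq_zero.1 h2.symm,
      degreeCast_degreeCast D (by omega)]
  -- With `d' = f(c) + ∂d`, one has `i(c) - ∂(0, 0, -d) = (c, 0, f(c)) + (0, d, ∂d) = (c, d, d')`.
  -- The casts identify degrees `n + 1 - 1` and `n`.
  refine ⟨c, ((0, 0, -degreeCast D (n + 1 - 1) n d) : C.X n × D.X (n - 1) × D.X n), h1.symm, ?_⟩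
  refine Prod.ext ?_ (Prod.ext ?_ ?_)
  · change c - C.d n (n + 1) 0 = c
    rw [map_zero, sub_zero]
  · change 0 - (degreeCast D n (n + 1 - 1) (-degreeCast D (n + 1 - 1) n d - f.f n 0) -
      D.d (n - 1) (n + 1 - 1) 0) = d
    rw [map_zero, map_zero, sub_zero, sub_zero, map_neg, degreeCast_degreeCast D (by omega),
      zero_sub, neg_neg]
  · change f.f _ c - D.d n (n + 1) (-degreeCast D (n + 1 - 1) n d) = d'
    rw [map_neg, h3]
    abel

theorem cocylπ_surjective (n : ℤ) : Function.Surjective ((cocylπ f).f n) := fun d =>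
  ⟨((0, 0, d) : C.X n × D.X (n - 1) × D.X n), rfl⟩

end Cocyl

/-! ### Surjections, disks and projective cofibrations of complexes -/

section Surjections

variable (R : Type u) [CommRing R]

/-- The degreewise surjective morphisms. -/
def surjections : MorphismProperty (Ch R) := fun _ _ f => ∀ n, Function.Surjective (f.f n)

/-- The degreewise surjective quasi-isomorphisms. -/
def trivialSurjections : MorphismProperty (Ch R) := fun _ _ f =>
  (∀ n, Function.Surjective (f.f n)) ∧ ∀ n, IsIso (HomologicalComplex.homologyMap f n)

theorem projectiveCofibrations_eq : projectiveCofibrations R = (trivialSurjections R).llp := by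
  rw [projectiveCofibrations]
  congr 1
  funext X Y f
  simp only [trivialSurjections, quasiIso_iff, quasiIsoAt_iff_isIso_homologyMap]

variable {R}

theorem surjections_llp_le_projectiveCofibrations :
    (surjections R).llp ≤ projectiveCofibrations R := by
  rw [projectiveCofibrations_eq]
  exact MorphismProperty.antitone_llp fun _ _ f hf => hf.1

/-- Lift the identity of `B` through the surjection `cocylπ i`. On homology the lift is split mono,
and it is epi because `i` followed by it is the quasi-isomorphism `cocylι i`; hence it is an
isomorphism, and so is `i`. -/
theorem isIso_homologyMap_of_llp_surjections {A B : Ch R} {i : A ⟶ B}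
    (hi : (surjections R).llp i) (n : ℤ) : IsIso (HomologicalComplex.homologyMap i n) := by
  have := hi (cocylπ i) (cocylπ_surjective i)
  have sq : CommSq (cocylι i) i (cocylπ i) (𝟙 B) :=
    ⟨by rw [cocylι_comp_cocylπ, Category.comp_id]⟩
  have h1 : HomologicalComplex.homologyMap i n ≫ HomologicalComplex.homologyMap sq.lift n =
      HomologicalComplex.homologyMap (cocylι i) n := by
    rw [← HomologicalComplex.homologyMap_comp, sq.fac_left]
  have h2 : HomologicalComplex.homologyMap sq.lift n ≫
      HomologicalComplex.homologyMap (cocylπ i) n = 𝟙 _ := by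
    rw [← HomologicalComplex.homologyMap_comp, sq.fac_right, HomologicalComplex.homologyMap_id]
  have h3 := isIso_homologyMap_cocylι i n
  have h4 : IsSplitMono (HomologicalComplex.homologyMap sq.lift n) := ⟨⟨⟨_, h2⟩⟩⟩
  have h5 : Epi (HomologicalComplex.homologyMap sq.lift n) := by
    rw [← h1] at h3
    exact epi_of_epi (HomologicalComplex.homologyMap i n) _
  have h6 : IsIso (HomologicalComplex.homologyMap sq.lift n) := isIso_of_epi_of_isSplitMono _
  rw [← h1] at h3
  exact IsIso.of_isIso_comp_right _ (HomologicalComplex.homologyMap sq.lift n)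

/-! ### Disks and spheres -/

variable (R) in
/-- The complex `R = R` in degrees `n` and `n + 1`. -/
abbrev disk (n : ℤ) : Ch R :=
  HomologicalComplex.double (𝟙 (ModuleCat.of R R)) (show (ComplexShape.up ℤ).Rel n (n + 1) from rfl)

/-- Morphisms from a disk are elements. -/
def diskEquiv (n : ℤ) (K : Ch R) : (disk R n ⟶ K) ≃ K.X n :=
  ((HomologicalComplex.evalCompCoyonedaCorepresentableByDoubleId
    (show (ComplexShape.up ℤ).Rel n (n + 1) from rfl) (by omega)
    (ModuleCat.of R R)).homEquiv (Y := K)).trans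
  (ModuleCat.homEquiv.trans (LinearMap.ringLmapEquivSelf R R (K.X n)).toEquiv)

theorem diskEquiv_comp {n : ℤ} {K L : Ch R} (g : disk R n ⟶ K) (f : K ⟶ L) :
    diskEquiv n L (g ≫ f) = f.f n (diskEquiv n K g) := rfl

theorem diskEquiv_symm_comp {n : ℤ} {K L : Ch R} (x : K.X n) (f : K ⟶ L) :
    (diskEquiv n K).symm x ≫ f = (diskEquiv n L).symm (f.f n x) := by
  apply (diskEquiv n L).injective
  rw [diskEquiv_comp, Equiv.apply_symm_apply, Equiv.apply_symm_apply]

variable (R) in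
/-- The complex `R` in degree `n`. -/
abbrev sphere (n : ℤ) : Ch R :=
  (HomologicalComplex.single (ModuleCat.{u} R) (ComplexShape.up ℤ) n).obj (ModuleCat.of R R)

/-- The value of a morphism from a sphere. -/
def sphereEval {n : ℤ} {K : Ch R} (g : sphere R n ⟶ K) : K.X n :=
  g.f n ((HomologicalComplex.singleObjXSelf (ComplexShape.up ℤ) n (ModuleCat.of R R)).inv (1 : R))

theorem sphereEval_injective {n : ℤ} {K : Ch R} :
    Function.Injective (sphereEval : (sphere R n ⟶ K) → K.X n) := by
  intro g g' h
  apply HomologicalComplex.from_single_hom_ext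
  rw [← cancel_epi (HomologicalComplex.singleObjXSelf _ n (ModuleCat.of R R)).inv]
  apply ModuleCat.hom_ext
  apply LinearMap.ext_ring
  exact h

theorem sphereEval_comp {n : ℤ} {K L : Ch R} (g : sphere R n ⟶ K) (f : K ⟶ L) :
    sphereEval (g ≫ f) = f.f n (sphereEval g) := rfl

theorem d_sphereEval {n : ℤ} {K : Ch R} (g : sphere R n ⟶ K) :
    K.d n (n + 1) (sphereEval g) = 0 := by
  have : g.f n ≫ K.d n (n + 1) = 0 := by
    rw [g.comm]
    exact (congrArg (· ≫ _) (HomologicalComplex.single_obj_d _ _ _ _ _)).trans zero_comp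
  exact ConcreteCategory.congr_hom this _

theorem exists_sphereEval_eq {n : ℤ} {K : Ch R} (z : K.X n) (hz : K.d n (n + 1) z = 0) :
    ∃ g : sphere R n ⟶ K, sphereEval g = z := by
  have hφ : ∀ k, (ComplexShape.up ℤ).Rel n k →
      ModuleCat.ofHom (LinearMap.toSpanSingleton R (K.X n) z) ≫ K.d n k = 0 := by
    intro k hk
    obtain rfl : n + 1 = k := hk
    apply ModuleCat.hom_ext
    apply LinearMap.ext_ring
    change K.d n (n + 1) ((1 : R) • z) = 0
    rw [one_smul, hz]
  refine ⟨HomologicalComplex.mkHomFromSingle _ hφ, ?_⟩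
  have : (HomologicalComplex.singleObjXSelf (ComplexShape.up ℤ) n (ModuleCat.of R R)).inv ≫
      (HomologicalComplex.mkHomFromSingle _ hφ).f n =
      ModuleCat.ofHom (LinearMap.toSpanSingleton R _ z) := by
    rw [HomologicalComplex.mkHomFromSingle_f, Iso.inv_hom_id_assoc]
  exact (ConcreteCategory.congr_hom this (1 : R)).trans (one_smul _ _)

variable (R) in
/-- The inclusion of the boundary sphere of a disk. -/
def sphereToDisk (n : ℤ) : sphere R (n + 1) ⟶ disk R n :=
  (exists_sphereEval_eq ((disk R n).d n (n + 1) (diskEquiv n _ (𝟙 _)))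
    (complex_d_d_apply _ _ _ _ _)).choose

theorem sphereEval_sphereToDisk_comp {n : ℤ} {K : Ch R} (g : disk R n ⟶ K) :
    sphereEval (sphereToDisk R n ≫ g) = K.d n (n + 1) (diskEquiv n K g) := by
  have h : sphereEval (sphereToDisk R n) = _ :=
    (exists_sphereEval_eq ((disk R n).d n (n + 1) (diskEquiv n _ (𝟙 _)))
      (complex_d_d_apply _ _ _ _ _)).choose_spec
  rw [sphereEval_comp, h, complex_comm_apply, ← diskEquiv_comp, Category.id_comp]

/-- Needed because the small object argument is run on monomorphisms. In degree `n + 1` the map is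
the identity of `R` up to isomorphism; elsewhere its source is zero. -/
instance mono_sphereToDisk (n : ℤ) : Mono (sphereToDisk R n) := by
  have h0 : (disk R n).d n (n + 1) (diskEquiv n _ (𝟙 _)) =
      (HomologicalComplex.doubleXIso₁ (𝟙 (ModuleCat.of R R))
        (show (ComplexShape.up ℤ).Rel n (n + 1) from rfl) (by omega)).inv (1 : R) := by
    have : (HomologicalComplex.doubleXIso₀ (𝟙 (ModuleCat.of R R))
        (show (ComplexShape.up ℤ).Rel n (n + 1) from rfl)).inv ≫ (disk R n).d n (n + 1) =
      (HomologicalComplex.doubleXIso₁ (𝟙 (ModuleCat.of R R))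
        (show (ComplexShape.up ℤ).Rel n (n + 1) from rfl) (by omega)).inv := by
      rw [HomologicalComplex.double_d _ _ (by omega), Category.id_comp, Iso.inv_hom_id_assoc]
    exact ConcreteCategory.congr_hom this (1 : R)
  have h1 : sphereEval (sphereToDisk R n) = _ :=
    (exists_sphereEval_eq ((disk R n).d n (n + 1) (diskEquiv n _ (𝟙 _)))
      (complex_d_d_apply _ _ _ _ _)).choose_spec
  have h2 : (HomologicalComplex.singleObjXSelf (ComplexShape.up ℤ) (n + 1)
      (ModuleCat.of R R)).inv ≫ (sphereToDisk R n).f (n + 1) =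
      (HomologicalComplex.doubleXIso₁ (𝟙 (ModuleCat.of R R))
        (show (ComplexShape.up ℤ).Rel n (n + 1) from rfl) (by omega)).inv := by
    apply ModuleCat.hom_ext
    apply LinearMap.ext_ring
    exact h1.trans h0
  have h3 : ∀ k, Mono ((sphereToDisk R n).f k) := by
    intro k
    by_cases hk : k = n + 1
    · subst hk
      rw [Iso.inv_comp_eq] at h2
      rw [h2]
      infer_instance
    · exact (HomologicalComplex.isZero_single_obj_X (ComplexShape.up ℤ) _ _ _ hk).mono _
  exact HomologicalComplex.mono_of_mono_f _ h3

/-- Elements can be killed: a morphism factors as a morphism with the left lifting property against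
degreewise surjections followed by a degreewise surjection. -/
theorem exists_factorization_surjections {A B : Ch R} (i : A ⟶ B) :
    ∃ (Z : Ch R) (j : A ⟶ Z) (p : Z ⟶ B), (surjections R).llp j ∧ surjections R p ∧ j ≫ p = i := by
  -- One disk for each element of `B`. Maps out of a disk are elements, so disks lift against
  -- surjections, and the added disks hit every element of `B`.
  let D : (Σ n, B.X n) → Ch R := fun x => disk R x.1
  let q : ∐ D ⟶ B := Sigma.desc fun x => (diskEquiv x.1 B).symm x.2
  refine ⟨A ⨿ ∐ D, coprod.inl, coprod.desc i q, ?_, ?_, coprod.inl_desc _ _⟩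
  · intro X Y f hf
    refine ⟨fun {t b} sq => ?_⟩
    have : ∀ x, ∃ y, f.f _ y = diskEquiv x.1 Y (Sigma.ι D x ≫ coprod.inr ≫ b) := fun x => hf _ _
    choose y hy using this
    refine ⟨⟨⟨coprod.desc t (Sigma.desc fun x => (diskEquiv x.1 X).symm (y x)),
      coprod.inl_desc _ _, ?_⟩⟩⟩
    apply coprod.hom_ext
    · rw [coprod.inl_desc_assoc, sq.w]
    · rw [coprod.inr_desc_assoc]
      apply Sigma.hom_ext
      intro x
      rw [Sigma.ι_desc_assoc, diskEquiv_symm_comp, hy, Equiv.symm_apply_apply]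
  · intro n y
    refine ⟨diskEquiv n _ (Sigma.ι D ⟨n, y⟩ ≫ coprod.inr), ?_⟩
    rw [← diskEquiv_comp, Category.assoc, coprod.inr_desc, Sigma.ι_desc, Equiv.apply_symm_apply]

/-- Retract argument: in a factorization `i = j ≫ p` the surjection `p` is a quasi-isomorphism by
two-out-of-three, so `i` lifts against it and is a retract of `j`. -/
theorem llp_surjections_of_isIso_homologyMap {A B : Ch R} {i : A ⟶ B}
    (hi : projectiveCofibrations R i) (h : ∀ n, IsIso (HomologicalComplex.homologyMap i n)) :
    (surjections R).llp i := by
  obtain ⟨Z, j, p, hj, hp, fac⟩ := exists_factorization_surjections i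
  rw [projectiveCofibrations_eq] at hi
  have hp' : ∀ n, IsIso (HomologicalComplex.homologyMap p n) := fun n => by
    have := isIso_homologyMap_of_llp_surjections hj n
    have h' := h n
    rw [← fac, HomologicalComplex.homologyMap_comp] at h'
    exact IsIso.of_isIso_comp_left (HomologicalComplex.homologyMap j n) _
  have := hi p ⟨hp, hp'⟩
  have sq : CommSq j i p (𝟙 B) := ⟨by rw [fac, Category.comp_id]⟩
  intro X Y f hf
  have := hj f hf
  refine ⟨fun {t b} sq' => ?_⟩
  have sq2 : CommSq t j f (p ≫ b) := ⟨by rw [sq'.w, ← fac, Category.assoc]⟩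
  exact ⟨⟨⟨sq.lift ≫ sq2.lift, by rw [sq.fac_left_assoc, sq2.fac_left],
    by rw [Category.assoc, sq2.fac_right, sq.fac_right_assoc, Category.id_comp]⟩⟩⟩

end Surjections

/-! ### Evaluation of left lifting properties -/

section Cofree

variable {R : Type u} [CommRing R] {P : Type u} [PartialOrder P]

/-- The right adjoint of the evaluation at `p`. -/
abbrev cofree (R : Type u) [CommRing R] (p : P) : Ch R ⥤ Pᵒᵖ ⥤ Ch R :=
  evaluationRightAdjoint (Ch R) (op p)

/-- The projection of the cofree functor. -/
def cofreeProj (A : Ch R) {p q : P} (h : p ≤ q) (n : ℤ) :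
    (((cofree R p).obj A).obj (op q)).X n →ₗ[R] A.X n :=
  ((Pi.π (fun _ : op q ⟶ op p => A) (homOfLE h).op).f n).hom

variable {A B : Ch R} {p : P}

theorem cofreeProj_ext {q : P} {n : ℤ} {x y : (((cofree R p).obj A).obj (op q)).X n}
    (h : ∀ h : p ≤ q, cofreeProj A h n x = cofreeProj A h n y) : x = y :=
  limit_complex_ext (G := Discrete.functor fun _ : op q ⟶ op p => A) fun j => by
    obtain ⟨j⟩ := j
    exact h (leOfHom j.unop)

theorem cofreeProj_exists (q : P) (n : ℤ) (a : A.X n) :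
    ∃ x : (((cofree R p).obj A).obj (op q)).X n, ∀ h : p ≤ q, cofreeProj A h n x = a := by
  obtain ⟨y, hy⟩ := limit_complex_exists (Discrete.functor fun _ : op q ⟶ op p => A)
    (fun _ => a) (by
      rintro ⟨j⟩ ⟨k⟩ f
      obtain rfl := Discrete.eq_of_hom f
      obtain rfl : f = 𝟙 _ := Subsingleton.elim _ _
      exact ConcreteCategory.congr_hom (HomologicalComplex.congr_hom
        ((Discrete.functor fun _ : op q ⟶ op p => A).map_id ⟨j⟩) n) a)
  exact ⟨y, fun h => hy ⟨(homOfLE h).op⟩⟩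

theorem cofreeProj_res {q r : P} (h : r ≤ q) (h' : p ≤ r) (n : ℤ)
    (x : (((cofree R p).obj A).obj (op q)).X n) :
    cofreeProj A h' n (res _ h n x) = cofreeProj A (h'.trans h) n x := by
  have : ((cofree R p).obj A).map (homOfLE h).op ≫
      Pi.π (fun _ : op r ⟶ op p => A) (homOfLE h').op =
      Pi.π (fun _ : op q ⟶ op p => A) (homOfLE (h'.trans h)).op :=
    limit.lift_π _ _
  exact ConcreteCategory.congr_hom (HomologicalComplex.congr_hom this n) x

theorem cofreeProj_map {q : P} (h : p ≤ q) (n : ℤ) (f : A ⟶ B)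
    (x : (((cofree R p).obj A).obj (op q)).X n) :
    cofreeProj B h n ((((cofree R p).map f).app (op q)).f n x) = f.f n (cofreeProj A h n x) := by
  have : ((cofree R p).map f).app (op q) ≫ Pi.π (fun _ : op q ⟶ op p => B) (homOfLE h).op =
      Pi.π (fun _ : op q ⟶ op p => A) (homOfLE h).op ≫ f :=
    limit.lift_π _ _
  exact ConcreteCategory.congr_hom (HomologicalComplex.congr_hom this n) x

theorem cofreeProj_d {q : P} (h : p ≤ q) (n m : ℤ)
    (x : (((cofree R p).obj A).obj (op q)).X n) :
    cofreeProj A h m ((((cofree R p).obj A).obj (op q)).d n m x) =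
      A.d n m (cofreeProj A h n x) :=
  complex_comm_apply _ _ _ _

/-- The cofree functor is `A` at the elements above `p` and zero elsewhere. At `p` the extension
problem is surjectivity of `f`; strictly above `p`, the value at `p` determines the extension. -/
theorem isMatchingSurjective_cofree {f : A ⟶ B} (hf : surjections R f) :
    IsMatchingSurjective ((cofree R p).map f) := by
  intro q n x y hx hxy
  by_cases hpq : p ≤ q
  · rcases hpq.eq_or_lt with rfl | hlt
    · obtain ⟨a, ha⟩ := hf n (cofreeProj B le_rfl n y)
      obtain ⟨z, hz⟩ := cofreeProj_exists (p := p) p n a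
      refine ⟨z, cofreeProj_ext fun h => ?_, fun r hr => cofreeProj_ext fun h => ?_⟩
      · rw [cofreeProj_map, hz, ha]
      · exact absurd hr h.not_gt
    · obtain ⟨z, hz⟩ := cofreeProj_exists (p := p) q n (cofreeProj A le_rfl n (x p))
      refine ⟨z, cofreeProj_ext fun h => ?_, fun r hr => cofreeProj_ext fun h => ?_⟩
      · rw [cofreeProj_map, hz, ← cofreeProj_map, hxy p hlt, cofreeProj_res]
      · rw [cofreeProj_res, hz]
        rcases h.eq_or_lt with rfl | h
        · rfl
        · rw [← hx r hr p h, cofreeProj_res]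
  · exact ⟨0, cofreeProj_ext fun h => absurd h hpq,
      fun r hr => cofreeProj_ext fun h => absurd (h.trans hr.le) hpq⟩

theorem isPointwiseQuasiIso_cofree [WellFoundedLT P] {f : A ⟶ B} (hf : trivialSurjections R f) :
    IsPointwiseQuasiIso ((cofree R p).map f) := by
  intro q
  refine isIso_homologyMap_of_surjective _ ((isMatchingSurjective_cofree hf.1).surjective q) ?_
  intro n a ha hfa
  by_cases hpq : p ≤ q
  · obtain ⟨w, hw, hw'⟩ := exists_d_eq_of_map_eq_zero f hf.1 hf.2 n (cofreeProj A hpq _ a)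
      (by rw [← cofreeProj_d, ha, map_zero]) (by rw [← cofreeProj_map, hfa, map_zero])
    obtain ⟨z, hz⟩ := cofreeProj_exists (p := p) q n w
    refine ⟨z, cofreeProj_ext fun h => ?_, cofreeProj_ext fun h => ?_⟩
    · rw [cofreeProj_d, hz, hw]
    · rw [cofreeProj_map, hz, hw', map_zero]
  · exact ⟨0, cofreeProj_ext fun h => absurd h hpq, cofreeProj_ext fun h => absurd h hpq⟩

/-! ### The classes of the model structure -/

variable (R P)

/-- The fibrations. -/
def matchingSurjections : MorphismProperty (Pᵒᵖ ⥤ Ch R) := fun _ _ η => IsMatchingSurjective η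

/-- The weak equivalences. -/
def pointwiseQuasiIsos : MorphismProperty (Pᵒᵖ ⥤ Ch R) := fun _ _ η => IsPointwiseQuasiIso η

/-- The cofibrations. -/
def pointwiseCofibrations : MorphismProperty (Pᵒᵖ ⥤ Ch R) := fun _ _ η =>
  ∀ p : P, projectiveCofibrations R (η.app (op p))

variable {R P}

/-- Transpose the lifting problem along the adjunction between evaluation at `p` and the cofree
functor. -/
theorem llp_matchingSurjections_app {F G : Pᵒᵖ ⥤ Ch R} {η : F ⟶ G}
    (h : (matchingSurjections R P).llp η) (p : P) : (surjections R).llp (η.app (op p)) := by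
  intro X Y f hf
  exact ((evaluationAdjunctionLeft (Ch R) (op p)).hasLiftingProperty_iff η f).2
    (h _ (isMatchingSurjective_cofree hf))

theorem matchingSurjections_llp_le :
    (matchingSurjections R P).llp ≤ pointwiseCofibrations R P ⊓ pointwiseQuasiIsos R P :=
  fun _ _ _ h => ⟨fun p => surjections_llp_le_projectiveCofibrations _
    (llp_matchingSurjections_app h p),
    fun p => isIso_homologyMap_of_llp_surjections (llp_matchingSurjections_app h p)⟩

variable [WellFoundedLT P]

theorem matchingSurjections_inf_llp_le :
    (matchingSurjections R P ⊓ pointwiseQuasiIsos R P).llp ≤ pointwiseCofibrations R P := by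
  intro F G η h p
  rw [projectiveCofibrations_eq]
  intro X Y f hf
  exact ((evaluationAdjunctionLeft (Ch R) (op p)).hasLiftingProperty_iff η f).2
    (h _ ⟨isMatchingSurjective_cofree hf.1, isPointwiseQuasiIso_cofree hf⟩)

theorem hasLiftingProperty_of_trivialCofibration {A B F G : Pᵒᵖ ⥤ Ch R} {i : A ⟶ B} {η : F ⟶ G}
    (hi : pointwiseCofibrations R P i) (hi' : pointwiseQuasiIsos R P i)
    (hη : matchingSurjections R P η) : HasLiftingProperty i η :=
  hasLiftingProperty_of_relativeMatchingMap i η fun p =>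
    llp_surjections_of_isIso_homologyMap (hi p) (hi' p) _
      ((relativeMatchingMap_surjective_iff η).2 hη p)

theorem hasLiftingProperty_of_trivialFibration {A B F G : Pᵒᵖ ⥤ Ch R} {i : A ⟶ B} {η : F ⟶ G}
    (hi : pointwiseCofibrations R P i) (hη : matchingSurjections R P η)
    (hη' : pointwiseQuasiIsos R P η) : HasLiftingProperty i η :=
  hasLiftingProperty_of_relativeMatchingMap i η fun p => by
    have hi := hi p
    rw [projectiveCofibrations_eq] at hi
    exact hi _ ⟨(relativeMatchingMap_surjective_iff η).2 hη p,
      hη.isIso_homologyMap_relativeMatchingMap hη' p⟩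

end Cofree

/-! ### The small object argument for monomorphisms -/

/-- In a Grothendieck abelian category, relative cell complexes on monomorphisms have monomorphic
transition maps. For `κ` regular and larger than the number of subobjects of each source, maps out
of these sources commute with the colimits of shape `κ` involved. -/
theorem hasSmallObjectArgument_of_le_monomorphisms {C : Type*} [Category.{u} C] [Abelian C]
    [IsGrothendieckAbelian.{u} C] (I : MorphismProperty C) [MorphismProperty.IsSmall.{u} I]
    (hI : I ≤ MorphismProperty.monomorphisms C) : MorphismProperty.HasSmallObjectArgument.{u} I := by
  obtain ⟨κ, hκ', hκ⟩ := HasCardinalLT.exists_regular_cardinal_forall.{u}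
    fun f : I.toSet => Subobject f.1.left
  have : Fact κ.IsRegular := ⟨hκ'⟩
  have : Nonempty κ.ord.ToType := by simpa using hκ'.ne_zero
  have := WellFoundedLT.toOrderBot κ.ord.ToType
  exact ⟨κ, inferInstance, inferInstance,
    { preservesColimit {A B X Y} i hi f hf := by
        let hf' : (MorphismProperty.monomorphisms C).TransfiniteCompositionOfShape κ.ord.ToType f :=
          { toTransfiniteCompositionOfShape := hf.toTransfiniteCompositionOfShape
            map_mem j hj := by
              have := (hf.attachCells j hj).pushouts_coproducts
              simp only [MorphismProperty.ofHoms_homFamily] at this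
              refine (?_ : _ ≤ MorphismProperty.monomorphisms C) _ this
              simpa only [MorphismProperty.pushouts_le_iff, MorphismProperty.coproducts_le_iff]
                using hI }
        have (j j' : κ.ord.ToType) (φ : j ⟶ j') : Mono (hf'.F.map φ) := hf'.mem_map φ
        exact IsGrothendieckAbelian.preservesColimit_coyoneda_obj_of_mono (Y := hf'.F) (κ := κ)
          (hκ ⟨Arrow.mk i, hi⟩) }⟩

/-! ### Generating cofibrations -/

section Generators

variable (R : Type u) [CommRing R] {P : Type u} [PartialOrder P]

/-- Presheaves are the sheaves for the trivial topology. -/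
instance functorCh_isGrothendieckAbelian : IsGrothendieckAbelian.{u} (Pᵒᵖ ⥤ Ch R) :=
  IsGrothendieckAbelian.of_equivalence (sheafBotEquivalence (C := P) (Ch R))

/-- The indicator presheaf of a lower set. -/
def indicator (S : LowerSet P) : Pᵒᵖ ⥤ Type u where
  obj q := ULift (PLift (q.unop ∈ S))
  map f := ↾ fun x => ⟨⟨S.lower (leOfHom f.unop) x.down.down⟩⟩

/-- The inclusion of indicator presheaves. -/
def indicatorMap {S T : LowerSet P} (h : S ≤ T) : indicator S ⟶ indicator T where
  app q := ↾ fun x => ⟨⟨h x.down.down⟩⟩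

instance mono_indicatorMap_app {S T : LowerSet P} (h : S ≤ T) (q : Pᵒᵖ) :
    Mono ((indicatorMap h).app q) := by
  rw [mono_iff_injective]
  rintro ⟨⟨_⟩⟩ ⟨⟨_⟩⟩ _
  rfl

theorem Iio_le_Iic (p : P) : LowerSet.Iio p ≤ LowerSet.Iic p := fun _ h => le_of_lt h

/-- The generating trivial cofibration at `p` in degree `n`. -/
def trivialCell (p : P) (n : ℤ) :
    (indicator (LowerSet.Iio p)) ⋙ sigmaConst.obj (disk R n) ⟶
      (indicator (LowerSet.Iic p)) ⋙ sigmaConst.obj (disk R n) :=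
  Functor.whiskerRight (indicatorMap (Iio_le_Iic p)) _

/-- The additional generating cofibration at `p` in degree `n`. -/
def boundaryCell (p : P) (n : ℤ) :=
  (evaluationLeftAdjoint (Ch R) (op p)).map (sphereToDisk R n)

variable (P) in
/-- The generating trivial cofibrations. -/
def trivialCells : MorphismProperty (Pᵒᵖ ⥤ Ch R) :=
  MorphismProperty.ofHoms fun x : P × ℤ => trivialCell R x.1 x.2

variable (P) in
/-- The generating cofibrations. -/
def cells : MorphismProperty (Pᵒᵖ ⥤ Ch R) :=
  trivialCells R P ⊔ MorphismProperty.ofHoms fun x : P × ℤ => boundaryCell R x.1 x.2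

instance (p : P) (n : ℤ) : Mono (trivialCell R p n) := by
  have : ∀ q, Mono ((trivialCell R p n).app q) := fun q =>
    have : Mono ((indicatorMap (Iio_le_Iic p)).app q) := mono_indicatorMap_app _ q
    (sigmaConst.obj (disk R n)).map_mono _
  exact NatTrans.mono_of_mono_app _

instance (p : P) (n : ℤ) : Mono (boundaryCell R p n) := by
  have : ∀ q, Mono ((boundaryCell R p n).app q) := fun q => by
    have e : (boundaryCell R p n).app q =
        Limits.Sigma.map fun _ : op p ⟶ q => sphereToDisk R n := by
      apply Sigma.hom_ext
      intro x
      refine (colimit.ι_desc _ _).trans ?_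
      exact (Sigma.ι_map (fun _ : op p ⟶ q => sphereToDisk R n) x).symm
    have (J : Type u) : (MorphismProperty.monomorphisms (Ch R)).IsStableUnderCoproductsOfShape J :=
      inferInstance
    rw [e]
    exact MorphismProperty.colimMap (W := MorphismProperty.monomorphisms (Ch R)) _
      (fun _ => inferInstanceAs (Mono (sphereToDisk R n)))
  exact NatTrans.mono_of_mono_app _

instance : MorphismProperty.IsSmall.{u} (trivialCells R P) := by
  dsimp only [trivialCells]; infer_instance

instance : MorphismProperty.IsSmall.{u} (cells R P) where
  small_toSet := by
    have h : Small.{u} (MorphismProperty.ofHoms fun x : P × ℤ => boundaryCell R x.1 x.2).toSet :=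
      inferInstance
    have h' : Small.{u} (trivialCells R P).toSet := inferInstance
    change Small.{u} ↑((trivialCells R P).toSet ∪
      (MorphismProperty.ofHoms fun x : P × ℤ => boundaryCell R x.1 x.2).toSet)
    infer_instance

instance : MorphismProperty.HasSmallObjectArgument.{u} (trivialCells R P) :=
  hasSmallObjectArgument_of_le_monomorphisms _ (by
    rintro _ _ _ ⟨x⟩
    exact inferInstanceAs (Mono (trivialCell R x.1 x.2)))

instance : MorphismProperty.HasSmallObjectArgument.{u} (cells R P) :=
  hasSmallObjectArgument_of_le_monomorphisms _ (by
    rintro _ _ _ (⟨⟨x⟩⟩ | ⟨⟨x⟩⟩)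
    · exact inferInstanceAs (Mono (trivialCell R x.1 x.2))
    · exact inferInstanceAs (Mono (boundaryCell R x.1 x.2)))

variable {R} {F G : Pᵒᵖ ⥤ Ch R} (η : F ⟶ G)

/-- Copowers of the disk are left adjoint to maps out of the disk; this turns the problem into one
about presheaves of sets. -/
theorem hasLiftingProperty_trivialCell_iff (p : P) (n : ℤ) :
    HasLiftingProperty (trivialCell R p n) η ↔
      HasLiftingProperty (indicatorMap (Iio_le_Iic p))
        (Functor.whiskerRight η (coyoneda.obj (op (disk R n)))) :=
  ((sigmaConstAdj (disk R n)).whiskerRight Pᵒᵖ).hasLiftingProperty_iff _ η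

theorem hasLiftingProperty_boundaryCell_iff (p : P) (n : ℤ) :
    HasLiftingProperty (boundaryCell R p n) η ↔
      HasLiftingProperty (sphereToDisk R n) (η.app (op p)) :=
  (evaluationAdjunctionRight (Ch R) (op p)).hasLiftingProperty_iff _ η

/-- The map from an indicator presheaf given by a compatible family. -/
def indicatorHom (S : LowerSet P) {n : ℤ} (x : ∀ q, (F.obj (op q)).X n)
    (hx : ∀ q ∈ S, ∀ r, ∀ h : r < q, res F h.le n (x q) = x r) :
    indicator S ⟶ F ⋙ coyoneda.obj (op (disk R n)) where
  app q := ↾ fun _ => (diskEquiv n (F.obj q)).symm (x q.unop)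
  naturality := by
    rintro ⟨q⟩ ⟨r⟩ f
    have h : r ≤ q := leOfHom f.unop
    ext ⟨⟨hq⟩⟩
    change (diskEquiv n (F.obj (op r))).symm (x r) =
      (diskEquiv n (F.obj (op q))).symm (x q) ≫ F.map f
    rw [diskEquiv_symm_comp]
    congr 1
    rcases h.eq_or_lt with rfl | h
    · exact (res_refl F _ n _).symm
    · exact (hx q hq r h).symm

/-- The element given by a map from an indicator presheaf. -/
def indicatorEval {S : LowerSet P} {n : ℤ} (t : indicator S ⟶ F ⋙ coyoneda.obj (op (disk R n)))
    {q : P} (hq : q ∈ S) : (F.obj (op q)).X n :=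
  diskEquiv n (F.obj (op q)) (t.app (op q) ⟨⟨hq⟩⟩)

theorem res_indicatorEval {S : LowerSet P} {n : ℤ}
    (t : indicator S ⟶ F ⋙ coyoneda.obj (op (disk R n))) {q r : P} (hq : q ∈ S) (h : r ≤ q) :
    res F h n (indicatorEval t hq) = indicatorEval t (S.lower h hq) := by
  have := ConcreteCategory.congr_hom (t.naturality (homOfLE h).op) ⟨⟨hq⟩⟩
  exact congrArg (diskEquiv n (F.obj (op r))) this.symm

theorem indicator_hom_ext {S : LowerSet P} {n : ℤ}
    {t t' : indicator S ⟶ F ⋙ coyoneda.obj (op (disk R n))}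
    (h : ∀ q, ∀ hq : q ∈ S, indicatorEval t hq = indicatorEval t' hq) : t = t' := by
  ext ⟨q⟩ ⟨⟨hq⟩⟩
  exact (diskEquiv n (F.obj (op q))).injective (h q hq)

theorem indicatorEval_indicatorHom (S : LowerSet P) {n : ℤ} (x : ∀ q, (F.obj (op q)).X n)
    (hx : ∀ q ∈ S, ∀ r, ∀ h : r < q, res F h.le n (x q) = x r) {q : P} (hq : q ∈ S) :
    indicatorEval (indicatorHom S x hx) hq = x q :=
  Equiv.apply_symm_apply (diskEquiv n (F.obj (op q))) _

theorem indicatorEval_comp {S : LowerSet P} {n : ℤ}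
    (t : indicator S ⟶ F ⋙ coyoneda.obj (op (disk R n))) {q : P} (hq : q ∈ S) :
    indicatorEval (t ≫ Functor.whiskerRight η _) hq =
      (η.app (op q)).f n (indicatorEval t hq) := rfl

theorem indicatorEval_map_comp {S T : LowerSet P} (h : S ≤ T) {n : ℤ}
    (t : indicator T ⟶ F ⋙ coyoneda.obj (op (disk R n))) {q : P} (hq : q ∈ S) :
    indicatorEval (indicatorMap h ≫ t) hq = indicatorEval t (h hq) := rfl

/-- The map from the indicator presheaf of `{q | q ≤ p}` given by an element. -/
def indicatorHomOfElement {p : P} {n : ℤ} (y : (F.obj (op p)).X n) :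
    indicator (LowerSet.Iic p) ⟶ F ⋙ coyoneda.obj (op (disk R n)) where
  app q := ↾ fun h => (diskEquiv n (F.obj q)).symm (res F (q := q.unop) h.down.down n y)
  naturality := by
    rintro ⟨q⟩ ⟨r⟩ f
    ext ⟨⟨hq⟩⟩
    have hq : q ≤ p := hq
    have h : r ≤ q := leOfHom f.unop
    change (diskEquiv n (F.obj (op r))).symm (res F (h.trans hq) n y) =
      (diskEquiv n (F.obj (op q))).symm (res F hq n y) ≫ F.map f
    rw [diskEquiv_symm_comp, ← res_res F hq h]
    rfl

theorem indicatorEval_indicatorHomOfElement {p : P} {n : ℤ} (y : (F.obj (op p)).X n) {q : P}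
    (hq : q ∈ LowerSet.Iic p) : 
    indicatorEval (indicatorHomOfElement y) hq = res F (LowerSet.mem_Iic_iff.1 hq) n y :=
  Equiv.apply_symm_apply (diskEquiv n (F.obj (op q))) _

/-- After transposition, a map from the indicator of `P_{<p}` is a compatible family below `p`, and
a map from that of `P_{≤p}` is an element at `p`. A lift is thus an extension of the family over the
given element. -/
theorem rlp_trivialCells : (trivialCells R P).rlp = matchingSurjections R P := by
  ext F G η
  constructor
  · intro h p n x y hx hxy
    have := (hasLiftingProperty_trivialCell_iff η p n).1 (h _ ⟨(p, n)⟩)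
    have hp : p ∈ LowerSet.Iic p := le_refl p
    have hx' : ∀ q ∈ LowerSet.Iio p, ∀ r, ∀ h : r < q, res F h.le n (x q) = x r := hx
    have sq : CommSq (indicatorHom (LowerSet.Iio p) x hx') (indicatorMap (Iio_le_Iic p))
        (Functor.whiskerRight η (coyoneda.obj (op (disk R n))))
        (indicatorHomOfElement (F := G) y) := ⟨by
      apply indicator_hom_ext
      intro q hq
      rw [indicatorEval_comp, indicatorEval_map_comp, indicatorEval_indicatorHom,
        indicatorEval_indicatorHomOfElement]
      exact hxy q hq⟩
    refine ⟨indicatorEval sq.lift hp, ?_, fun q hq => ?_⟩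
    · rw [← indicatorEval_comp, sq.fac_right, indicatorEval_indicatorHomOfElement, res_refl]
    · rw [res_indicatorEval]
      have hq' : q ∈ LowerSet.Iio p := hq
      have := indicatorEval_map_comp (Iio_le_Iic p) sq.lift hq'
      rw [sq.fac_left, indicatorEval_indicatorHom] at this
      exact this.symm
  · rintro hη _ _ _ ⟨⟨p, n⟩⟩
    refine (hasLiftingProperty_trivialCell_iff η p n).2 ⟨fun {t b} sq => ?_⟩
    have hp : p ∈ LowerSet.Iic p := le_refl p
    have hsq : ∀ q, ∀ hq : q ∈ LowerSet.Iio p, (η.app (op q)).f n (indicatorEval t hq) =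
        res G (le_of_lt hq) n (indicatorEval b hp) := fun q hq => by
      rw [res_indicatorEval, ← indicatorEval_comp, sq.w, indicatorEval_map_comp]
    classical
    obtain ⟨z, hz, hz'⟩ := hη p n
      (fun q => if hq : q ∈ LowerSet.Iio p then indicatorEval t hq else 0) (indicatorEval b hp)
      (by
        intro q hq r hr
        have hq : q ∈ LowerSet.Iio p := hq
        have hr' : r ∈ LowerSet.Iio p := (LowerSet.Iio p).lower hr.le hq
        simp only [dif_pos hq, dif_pos hr', res_indicatorEval])
      (by
        intro q hq
        have hq : q ∈ LowerSet.Iio p := hq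
        simp only [dif_pos hq, hsq])
    refine ⟨⟨⟨indicatorHomOfElement z, indicator_hom_ext fun q hq => ?_,
      indicator_hom_ext fun q hq => ?_⟩⟩⟩
    · rw [indicatorEval_map_comp, indicatorEval_indicatorHomOfElement, hz' q hq, dif_pos hq]
    · rw [indicatorEval_comp, indicatorEval_indicatorHomOfElement, ← res_app, hz,
        res_indicatorEval]

theorem hasLiftingProperty_sphereToDisk {A B : Ch R} {f : A ⟶ B} (hf : trivialSurjections R f)
    (n : ℤ) : HasLiftingProperty (sphereToDisk R n) f := by
  refine ⟨fun {t b} sq => ?_⟩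
  obtain ⟨c, hc⟩ := hf.1 n (diskEquiv n B b)
  have h1 : f.f (n + 1) (sphereEval t) = B.d n (n + 1) (diskEquiv n B b) := by
    rw [← sphereEval_comp, sq.w, sphereEval_sphereToDisk_comp]
  -- The square is a cocycle `a` of `A` together with a primitive of `f(a)`. A lift `c` of that
  -- primitive is corrected by an element `w` of the exact kernel.
  obtain ⟨w, hw, hw'⟩ := exists_d_eq_of_map_eq_zero f hf.1 hf.2 n (sphereEval t - A.d _ _ c)
    (by rw [map_sub, d_sphereEval, complex_d_d_apply, sub_zero])
    (by rw [map_sub, complex_comm_apply, hc, h1, sub_self])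
  refine ⟨⟨⟨(diskEquiv n A).symm (c + w), sphereEval_injective ?_, ?_⟩⟩⟩
  · rw [sphereEval_sphereToDisk_comp, Equiv.apply_symm_apply, map_add, hw]
    abel
  · rw [diskEquiv_symm_comp, map_add, hc, hw', add_zero, Equiv.symm_apply_apply]

theorem trivialSurjections_of_hasLiftingProperty {A B : Ch R} {f : A ⟶ B}
    (hs : surjections R f) (h : ∀ n, HasLiftingProperty (sphereToDisk R n) f) :
    trivialSurjections R f := by
  refine ⟨hs, isIso_homologyMap_of_surjective f hs fun n a ha hfa => ?_⟩
  obtain ⟨t, rfl⟩ := exists_sphereEval_eq a ha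
  have := h n
  have sq : CommSq t (sphereToDisk R n) f ((diskEquiv n B).symm 0) := ⟨by
    apply sphereEval_injective
    rw [sphereEval_comp, hfa, sphereEval_sphereToDisk_comp, Equiv.apply_symm_apply, map_zero]⟩
  refine ⟨diskEquiv n A sq.lift, ?_, ?_⟩
  · rw [← sphereEval_sphereToDisk_comp, sq.fac_left]
  · rw [← diskEquiv_comp, sq.fac_right, Equiv.apply_symm_apply]

/-- Once `η` is pointwise surjective, lifting against the sphere-to-disk maps at `p` amounts to
exactness of the kernel of `η_p`. -/
theorem rlp_cells [WellFoundedLT P] :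
    (cells R P).rlp = matchingSurjections R P ⊓ pointwiseQuasiIsos R P := by
  ext F G η
  constructor
  · intro h
    have h1 : matchingSurjections R P η := by
      rw [← rlp_trivialCells]
      exact fun _ _ i hi => h i (Or.inl hi)
    refine ⟨h1, fun p => (trivialSurjections_of_hasLiftingProperty (h1.surjective p)
      fun n => ?_).2⟩
    exact (hasLiftingProperty_boundaryCell_iff η p n).1 (h _ (Or.inr ⟨(p, n)⟩))
  · rintro ⟨h1, h2⟩ _ _ i (hi | ⟨⟨p, n⟩⟩)
    · rw [← rlp_trivialCells] at h1
      exact h1 i hi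
    · exact (hasLiftingProperty_boundaryCell_iff η p n).2
        (hasLiftingProperty_sphereToDisk ⟨h1.surjective p, h2 p⟩ n)

end Generators

/-! ### The model structure -/

section Model

variable (R : Type u) [CommRing R] (P : Type u) [PartialOrder P]

/-- As an intersection of inverse images of isomorphisms, the class inherits two-out-of-three and
stability under retracts. -/
theorem pointwiseQuasiIsos_iff {F G : Pᵒᵖ ⥤ Ch R} (η : F ⟶ G) :
    pointwiseQuasiIsos R P η ↔ ∀ (p : P) (n : ℤ), (MorphismProperty.isomorphisms _).inverseImage
      ((evaluation Pᵒᵖ (Ch R)).obj (op p) ⋙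
        HomologicalComplex.homologyFunctor (ModuleCat.{u} R) (ComplexShape.up ℤ) n) η :=
  Iff.rfl

instance : (pointwiseQuasiIsos R P).HasTwoOutOfThreeProperty where
  comp_mem f g hf hg := by
    rw [pointwiseQuasiIsos_iff] at *
    exact fun p n => MorphismProperty.comp_mem _ _ _ (hf p n) (hg p n)
  of_postcomp f g hg hfg := by
    rw [pointwiseQuasiIsos_iff] at *
    exact fun p n => MorphismProperty.of_postcomp _ _ _ (hg p n) (hfg p n)
  of_precomp f g hf hfg := by
    rw [pointwiseQuasiIsos_iff] at *
    exact fun p n => MorphismProperty.of_precomp _ _ _ (hf p n) (hfg p n)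

instance : (pointwiseQuasiIsos R P).IsStableUnderRetracts where
  of_retract h hg := by
    rw [pointwiseQuasiIsos_iff] at *
    exact fun p n => MorphismProperty.of_retract h (hg p n)

instance : (matchingSurjections R P).IsStableUnderRetracts := by
  rw [← rlp_trivialCells]
  infer_instance

instance : (pointwiseCofibrations R P).IsStableUnderRetracts where
  of_retract h hg p := by
    have := hg p
    rw [projectiveCofibrations_eq] at this ⊢
    exact MorphismProperty.of_retract (RetractArrow.map h ((evaluation Pᵒᵖ (Ch R)).obj (op p))) this

variable {R P} in
theorem matchingSurjections_of_isZero {F G : Pᵒᵖ ⥤ Ch R} (η : F ⟶ G) (hG : IsZero G) :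
    matchingSurjections R P η ↔ IsFlasque F := by
  have h0 : ∀ (p : P) (n : ℤ) (x y : (G.obj (op p)).X n), x = y := fun p n x y => by
    have h : IsZero ((G.obj (op p)).X n) :=
      ((evaluation Pᵒᵖ (Ch R)).obj (op p) ⋙
        HomologicalComplex.eval (ModuleCat.{u} R) (ComplexShape.up ℤ) n).map_isZero hG
    have := ModuleCat.subsingleton_of_isZero h
    exact Subsingleton.elim _ _
  constructor
  · intro h p n x hx
    obtain ⟨z, -, hz⟩ := h p n x 0 hx fun _ _ => h0 _ _ _ _
    exact ⟨z, hz⟩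
  · intro h p n x y hx _
    obtain ⟨z, hz⟩ := h p n x hx
    exact ⟨z, h0 _ _ _ _, hz⟩

theorem trivialCofibration_fibration_factorization {F G : Pᵒᵖ ⥤ Ch R} (η : F ⟶ G) :
    ∃ (Z : Pᵒᵖ ⥤ Ch R) (i : F ⟶ Z) (q : Z ⟶ G), i ≫ q = η ∧ pointwiseCofibrations R P i ∧
      pointwiseQuasiIsos R P i ∧ matchingSurjections R P q := by
  have : MorphismProperty.HasFactorization (matchingSurjections R P).llp
      (matchingSurjections R P) := by
    rw [← rlp_trivialCells]
    infer_instance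
  have h := MorphismProperty.factorizationData (matchingSurjections R P).llp
    (matchingSurjections R P) η
  exact ⟨h.Z, h.i, h.p, h.fac, (matchingSurjections_llp_le _ h.hi).1,
    (matchingSurjections_llp_le _ h.hi).2, h.hp⟩

variable [WellFoundedLT P]

theorem cofibration_trivialFibration_factorization {F G : Pᵒᵖ ⥤ Ch R} (η : F ⟶ G) :
    ∃ (Z : Pᵒᵖ ⥤ Ch R) (i : F ⟶ Z) (q : Z ⟶ G), i ≫ q = η ∧ pointwiseCofibrations R P i ∧
      matchingSurjections R P q ∧ pointwiseQuasiIsos R P q := by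
  have : MorphismProperty.HasFactorization (matchingSurjections R P ⊓ pointwiseQuasiIsos R P).llp
      (matchingSurjections R P ⊓ pointwiseQuasiIsos R P) := by
    rw [← rlp_cells]
    infer_instance
  have h := MorphismProperty.factorizationData (matchingSurjections R P ⊓ pointwiseQuasiIsos R P).llp
    (matchingSurjections R P ⊓ pointwiseQuasiIsos R P) η
  exact ⟨h.Z, h.i, h.p, h.fac, matchingSurjections_inf_llp_le _ h.hi, h.hp.1, h.hp.2⟩

/-- The model structure on `Fun(Pᵒᵖ, Ch R)`. -/
@[reducible]
def posetModelCategory : ModelCategory (Pᵒᵖ ⥤ Ch R) where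
  categoryWithFibrations := ⟨matchingSurjections R P⟩
  categoryWithCofibrations := ⟨pointwiseCofibrations R P⟩
  categoryWithWeakEquivalences := ⟨pointwiseQuasiIsos R P⟩
  cm2 := inferInstanceAs (pointwiseQuasiIsos R P).HasTwoOutOfThreeProperty
  cm3a := inferInstanceAs (pointwiseQuasiIsos R P).IsStableUnderRetracts
  cm3b := inferInstanceAs (matchingSurjections R P).IsStableUnderRetracts
  cm3c := inferInstanceAs (pointwiseCofibrations R P).IsStableUnderRetracts
  cm4a i p hi hi' hp := hasLiftingProperty_of_trivialCofibration hi.mem hi'.mem hp.mem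
  cm4b i p hi hp hp' := hasLiftingProperty_of_trivialFibration hi.mem hp.mem hp'.mem
  cm5a := ⟨fun {F G} η => by
    obtain ⟨Z, i, q, fac, h1, h2, h3⟩ := trivialCofibration_fibration_factorization R P η
    exact ⟨⟨Z, i, q, fac, ⟨h1, h2⟩, h3⟩⟩⟩
  cm5b := ⟨fun {F G} η => by
    obtain ⟨Z, i, q, fac, h1, h2, h3⟩ := cofibration_trivialFibration_factorization R P η
    exact ⟨⟨Z, i, q, fac, h1, ⟨h2, h3⟩⟩⟩⟩

variable {R P}

theorem isZero_terminal (C : Type*) [Category* C] [Preadditive C] [HasZeroObject C]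
    [HasTerminal C] : IsZero (⊤_ C) :=
  IsZero.of_iso (isZero_zero _) (terminalIsTerminal.uniqueUpToIso HasZeroObject.zeroIsTerminal)

theorem isFibrant_iff_isFlasque (F : Pᵒᵖ ⥤ Ch R) :
    letI := posetModelCategory R P
    IsFibrant F ↔ IsFlasque F := by
  let _ := posetModelCategory R P
  rw [HomotopicalAlgebra.isFibrant_iff, HomotopicalAlgebra.fibration_iff]
  exact matchingSurjections_of_isZero _ (isZero_terminal _)

end Model

/-! ### Extension by zero and limits -/

section MapExtend

variable {C D : Type*} [Category* C] [Category* D] [Preadditive C] [Preadditive D]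
  [HasZeroObject C] [HasZeroObject D] (L : C ⥤ D) [L.Additive] {ι ι' : Type*}
  {c : ComplexShape ι} {c' : ComplexShape ι'}

/-- The components of `mapExtendIso`. -/
def mapExtendXIso (K : HomologicalComplex C c) : ∀ i : Option ι,
    L.obj (HomologicalComplex.extend.X K i) ≅
      HomologicalComplex.extend.X ((L.mapHomologicalComplex c).obj K) i
  | none => (L.map_isZero (isZero_zero C)).iso (isZero_zero D)
  | some _ => Iso.refl _

theorem mapExtendXIso_hom_d (K : HomologicalComplex C c) : ∀ i j : Option ι,
    (mapExtendXIso L K i).hom ≫ HomologicalComplex.extend.d _ i j =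
      L.map (HomologicalComplex.extend.d K i j) ≫ (mapExtendXIso L K j).hom
  | none, _ => (L.map_isZero (isZero_zero C)).eq_of_src _ _
  | some _, none => (isZero_zero D).eq_of_tgt _ _
  | some _, some _ => (Category.id_comp _).trans (Category.comp_id _).symm

/-- Additive functors commute with the extension of complexes by zero. -/
def mapExtendIso (e : c.Embedding c') (K : HomologicalComplex C c) :
    (L.mapHomologicalComplex c').obj (K.extend e) ≅ ((L.mapHomologicalComplex c).obj K).extend e :=
  HomologicalComplex.Hom.isoOfComponents (fun i => mapExtendXIso L K (e.r i))
    fun i j _ => mapExtendXIso_hom_d L K (e.r i) (e.r j)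

end MapExtend

section

variable {R : Type u} [CommRing R] {J : Type u} [Category.{u} J]

/-- The components of `limitAsFunctorIso`. -/
def limitAsFunctorXIso (K : CochainComplex (J ⥤ ModuleCat.{u} R) ℤ) (n : ℤ) :
    (limit K.asFunctor).X n ≅ limit (K.X n) :=
  preservesLimitIso (HomologicalComplex.eval (ModuleCat.{u} R) (ComplexShape.up ℤ) n) K.asFunctor

theorem limitAsFunctorXIso_hom_π (K : CochainComplex (J ⥤ ModuleCat.{u} R) ℤ) (n : ℤ) (j : J) :
    (limitAsFunctorXIso K n).hom ≫ limit.π (K.X n) j = (limit.π K.asFunctor j).f n :=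
  preservesLimitIso_hom_π (HomologicalComplex.eval (ModuleCat.{u} R) (ComplexShape.up ℤ) n)
    K.asFunctor j

theorem limitAsFunctorXIso_hom_d (K : CochainComplex (J ⥤ ModuleCat.{u} R) ℤ) (n m : ℤ) :
    (limitAsFunctorXIso K n).hom ≫ limMap (K.d n m) =
      (limit K.asFunctor).d n m ≫ (limitAsFunctorXIso K m).hom := by
  apply limit.hom_ext
  intro j
  rw [Category.assoc, Category.assoc, limMap_π, limitAsFunctorXIso_hom_π,
    ← Category.assoc, limitAsFunctorXIso_hom_π]
  exact (limit.π K.asFunctor j).comm n m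

/-- Limits of complexes are computed degreewise. -/
def limitAsFunctorIso (K : CochainComplex (J ⥤ ModuleCat.{u} R) ℤ) :
    limit K.asFunctor ≅
      ((lim : (J ⥤ ModuleCat.{u} R) ⥤ ModuleCat.{u} R).mapHomologicalComplex _).obj K :=
  HomologicalComplex.Hom.isoOfComponents (fun n => limitAsFunctorXIso K n)
    fun n m _ => limitAsFunctorXIso_hom_d K n m

end

/-! ### Higher limits through injective and flasque functors -/

section

variable {R : Type u} [CommRing R] {P : Type u} [PartialOrder P]

theorem computesCohomology_limit_injectiveResolution {F : Pᵒᵖ ⥤ ModuleCat.{u} R}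
    (I : InjectiveResolution F) : ComputesCohomology F (limit I.cochainComplex.asFunctor) := by
  let L : (Pᵒᵖ ⥤ ModuleCat.{u} R) ⥤ ModuleCat.{u} R := lim
  -- The `ℤ`-indexed complex of `I` extends an `ℕ`-indexed one by zero. Since `lim` commutes with
  -- this extension, the homology is the derived functor in degrees `n ≥ 0` and zero in negative
  -- degrees.
  let e : limit I.cochainComplex.asFunctor ≅
      ((L.mapHomologicalComplex _).obj I.cocomplex).extend ComplexShape.embeddingUpNat :=
    limitAsFunctorIso _ ≪≫ mapExtendIso L _ _
  refine ⟨fun n => ⟨I.isoRightDerivedObj L n ≪≫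
    (HomologicalComplex.extendHomologyIso _ ComplexShape.embeddingUpNat rfl).symm ≪≫
    (HomologicalComplex.homologyMapIso e (n : ℤ)).symm⟩, fun n hn => ?_⟩
  refine IsZero.of_iso ?_ (HomologicalComplex.homologyMapIso e n)
  refine (HomologicalComplex.exactAt_iff_isZero_homology _ _).1
    (HomologicalComplex.extend_exactAt _ _ _ fun k hk => ?_)
  have : (k : ℤ) = n := hk
  omega

/-- A compatible family below `p` is a map to `E` from the free module functor on the indicator of
`P_{<p}`. That functor embeds in the one for `P_{≤p}`, so injectivity extends the map; its value at
`p` is the required element. -/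
theorem injective_exists_extension (E : Pᵒᵖ ⥤ ModuleCat.{u} R) [Injective E] (p : P)
    (x : ∀ q, E.obj (op q))
    (hx : ∀ q < p, ∀ r, ∀ h : r < q, E.map (homOfLE h.le).op (x q) = x r) :
    ∃ z, ∀ q, ∀ h : q < p, E.map (homOfLE h.le).op z = x q := by
  let adj := (ModuleCat.adj R).whiskerRight Pᵒᵖ
  let t : indicator (LowerSet.Iio p) ⟶ E ⋙ forget _ :=
    { app q := ↾ fun _ => x q.unop
      naturality := by
        rintro ⟨q⟩ ⟨r⟩ f
        ext ⟨⟨hq⟩⟩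
        have hq : q < p := hq
        have h : r ≤ q := leOfHom f.unop
        change x r = E.map f (x q)
        rcases h.eq_or_lt with rfl | h
        · exact (ConcreteCategory.congr_hom (E.map_id _) (x r)).symm
        · exact (hx q hq r h).symm }
  let φ := Functor.whiskerRight (indicatorMap (Iio_le_Iic p)) (ModuleCat.free R)
  have : Mono φ := by
    have : ∀ q, Mono (φ.app q) := fun q => by
      rw [ModuleCat.mono_iff_injective]
      exact Finsupp.mapDomain_injective
        ((mono_iff_injective _).1 (mono_indicatorMap_app (Iio_le_Iic p) q))
    exact NatTrans.mono_of_mono_app _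
  obtain ⟨g, hg⟩ := Injective.factors ((adj.homEquiv _ _).symm t) φ
  let s : indicator (LowerSet.Iic p) ⟶ E ⋙ forget _ := adj.homEquiv _ _ g
  have hs : indicatorMap (Iio_le_Iic p) ≫ s = t := by
    rw [← (adj.homEquiv _ _).apply_symm_apply t, ← hg]
    exact (adj.homEquiv_naturality_left (indicatorMap (Iio_le_Iic p)) g).symm
  refine ⟨s.app (op p) ⟨⟨le_refl p⟩⟩, fun q hq => ?_⟩
  have h1 := ConcreteCategory.congr_hom (s.naturality (homOfLE hq.le).op) ⟨⟨le_refl p⟩⟩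
  have h2 := ConcreteCategory.congr_hom (NatTrans.congr_app hs (op q)) ⟨⟨hq⟩⟩
  exact h1.symm.trans h2

theorem isFlasque_of_injective (K : CochainComplex (Pᵒᵖ ⥤ ModuleCat.{u} R) ℤ)
    [∀ n, Injective (K.X n)] : IsFlasque K.asFunctor := fun p n x hx =>
  injective_exists_extension (K.X n) p x hx

/-- The components of `singleToAsFunctor`. -/
def singleToAsFunctorApp {F : Pᵒᵖ ⥤ ModuleCat.{u} R} {K : CochainComplex (Pᵒᵖ ⥤ ModuleCat.{u} R) ℤ}
    (φ : (HomologicalComplex.single _ (ComplexShape.up ℤ) 0).obj F ⟶ K) (t : Pᵒᵖ) :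
    (inDegreeZero F).obj t ⟶ K.asFunctor.obj t :=
  (HomologicalComplex.singleMapHomologicalComplex
      ((evaluation _ (ModuleCat.{u} R)).obj t) (ComplexShape.up ℤ) 0).inv.app F ≫
    (((evaluation _ (ModuleCat.{u} R)).obj t).mapHomologicalComplex _).map φ

theorem singleToAsFunctorApp_f_zero {F : Pᵒᵖ ⥤ ModuleCat.{u} R}
    {K : CochainComplex (Pᵒᵖ ⥤ ModuleCat.{u} R) ℤ}
    (φ : (HomologicalComplex.single _ (ComplexShape.up ℤ) 0).obj F ⟶ K) (t : Pᵒᵖ) :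
    (singleToAsFunctorApp φ t).f 0 =
      (HomologicalComplex.singleObjXSelf (ComplexShape.up ℤ) 0 (F.obj t)).hom ≫
        ((HomologicalComplex.singleObjXSelf (ComplexShape.up ℤ) 0 F).inv ≫ φ.f 0).app t := by
  refine (HomologicalComplex.comp_f _ _ _).trans ?_
  rw [HomologicalComplex.singleMapHomologicalComplex_inv_app_self]
  exact Category.assoc _ _ _

/-- The morphism of functors to complexes given by a morphism of complexes of functors. -/
def singleToAsFunctor {F : Pᵒᵖ ⥤ ModuleCat.{u} R} {K : CochainComplex (Pᵒᵖ ⥤ ModuleCat.{u} R) ℤ}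
    (φ : (HomologicalComplex.single _ (ComplexShape.up ℤ) 0).obj F ⟶ K) :
    inDegreeZero F ⟶ K.asFunctor where
  app := singleToAsFunctorApp φ
  naturality s t f := by
    apply HomologicalComplex.from_single_hom_ext
    have h := ((HomologicalComplex.singleObjXSelf (ComplexShape.up ℤ) 0 F).inv ≫
      φ.f 0).naturality f
    refine (HomologicalComplex.comp_f _ _ _).trans
      (Eq.trans ?_ (HomologicalComplex.comp_f _ _ _).symm)
    rw [singleToAsFunctorApp_f_zero, singleToAsFunctorApp_f_zero]
    refine (congrArg (· ≫ _) (HomologicalComplex.single_map_f_self (c := ComplexShape.up ℤ) 0 (F.map f))).trans ?_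
    exact (Category.assoc _ _ _).trans ((congrArg (_ ≫ ·) ((Category.assoc _ _ _).trans
      (congrArg (_ ≫ ·) (Iso.inv_hom_id_assoc _ _)))).trans
        ((congrArg (_ ≫ ·) h).trans (Category.assoc _ _ _).symm))

theorem isPointwiseQuasiIso_singleToAsFunctor {F : Pᵒᵖ ⥤ ModuleCat.{u} R}
    {K : CochainComplex (Pᵒᵖ ⥤ ModuleCat.{u} R) ℤ}
    (φ : (HomologicalComplex.single _ (ComplexShape.up ℤ) 0).obj F ⟶ K) (hφ : QuasiIso φ) :
    IsPointwiseQuasiIso (singleToAsFunctor φ) := by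
  intro p n
  have := (HomologicalComplex.quasiIso_iff_evaluation φ).1 hφ (op p)
  have : QuasiIso (singleToAsFunctorApp φ (op p)) :=
    quasiIso_comp (hφ := inferInstance) (hφ' := this)
  exact inferInstanceAs (IsIso (HomologicalComplex.homologyMap (singleToAsFunctorApp φ (op p)) n))

theorem IsMatchingSurjective.isFlasque {F G : Pᵒᵖ ⥤ Ch R} {η : F ⟶ G}
    (hη : IsMatchingSurjective η) (hG : IsFlasque G) : IsFlasque F := by
  intro p n x hx
  obtain ⟨y, hy⟩ := hG p n (fun q => (η.app (op q)).f n (x q)) (fun q hq r hr => by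
    rw [res_app, hx q hq r hr])
  obtain ⟨z, -, hz⟩ := hη p n x y hx fun q hq => (hy q hq).symm
  exact ⟨z, hz⟩

/-- Any flasque replacement computes cohomology. -/
theorem computesCohomology_of_flasque [WellFoundedLT P] {F : Pᵒᵖ ⥤ ModuleCat.{u} R}
    {G : Pᵒᵖ ⥤ Ch R} (i : inDegreeZero F ⟶ G) (hi : IsPointwiseQuasiIso i) (hG : IsFlasque G) :
    ComputesCohomology F (limit G) := by
  let I := injectiveResolution F
  have hI : IsFlasque I.cochainComplex.asFunctor := isFlasque_of_injective _
  let ψ : inDegreeZero F ⟶ I.cochainComplex.asFunctor := singleToAsFunctor I.ι'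
  have hι : QuasiIso I.ι' := inferInstance
  have hψ : IsPointwiseQuasiIso ψ := isPointwiseQuasiIso_singleToAsFunctor I.ι' hι
  -- Since `i` need not be a cofibration, `ψ` cannot be extended along it directly. It is extended
  -- along `j` instead, giving a zigzag `G ← Z → I` of weak equivalences between flasque functors.
  obtain ⟨Z, j, q, fac, hj, hj', hq⟩ := trivialCofibration_fibration_factorization R P i
  have hZ : IsFlasque Z := IsMatchingSurjective.isFlasque hq hG
  have hq' : pointwiseQuasiIsos R P q :=
    MorphismProperty.of_precomp (pointwiseQuasiIsos R P) j q hj' (by rwa [fac])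
  have := hasLiftingProperty_of_trivialCofibration hj hj'
    ((matchingSurjections_of_isZero (terminal.from I.cochainComplex.asFunctor)
      (isZero_terminal _)).2 hI)
  have sq : CommSq ψ j (terminal.from I.cochainComplex.asFunctor) (terminal.from Z) :=
    ⟨Subsingleton.elim _ _⟩
  have hl : pointwiseQuasiIsos R P sq.lift :=
    MorphismProperty.of_precomp (pointwiseQuasiIsos R P) j sq.lift hj' (by rwa [sq.fac_left])
  have e (n : ℤ) : (limit I.cochainComplex.asFunctor).homology n ≅ (limit G).homology n :=
    have := isIso_homologyMap_limMap q hZ hG hq' n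
    have := isIso_homologyMap_limMap sq.lift hZ hI hl n
    (asIso (HomologicalComplex.homologyMap (limMap sq.lift) n)).symm ≪≫
      asIso (HomologicalComplex.homologyMap (limMap q) n)
  obtain ⟨h1, h2⟩ := computesCohomology_limit_injectiveResolution I
  exact ⟨fun n => (h1 n).map fun f => f ≪≫ e n, fun n hn => (h2 n hn).of_iso (e n).symm⟩

end

/-! ### The cocylinder as a fibrant replacement -/

section Cocylinder

variable {R : Type u} [CommRing R] {P : Type u} [PartialOrder P]

section

variable [FilteredPoset P] (F : Pᵒᵖ ⥤ Ch R)

theorem isPointwiseQuasiIso_cocylinderι : IsPointwiseQuasiIso (cocylinderι F) := by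
  intro p n
  have h : (cocylinderι F).app (op p) =
      cocylι (cocylinderε F p) ≫ eqToHom (cocylinder_obj F p).symm := by
    rw [← cocylinderι_app, Category.assoc, eqToHom_trans, eqToHom_refl, Category.comp_id]
  have := isIso_homologyMap_cocylι (cocylinderε F p) n
  rw [h, HomologicalComplex.homologyMap_comp]
  infer_instance

/-- The transition maps of the cocylinder are `π` followed by the limit projections. This identity
makes its matching maps surjective. -/
theorem matchingMap_cocylinder (p : P) :
    matchingMap (cocylinder F) p =
      eqToHom (cocylinder_obj F p) ≫ cocylπ (cocylinderε F p) := by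
  apply limit.hom_ext
  intro q
  refine (limit.lift_π _ _).trans ?_
  rw [Category.assoc]
  exact cocylinder_map F p q.unop.1 q.unop.2

theorem isFlasque_cocylinder : IsFlasque (cocylinder F) := by
  rw [← matchingMap_surjective_iff]
  intro p n
  rw [matchingMap_cocylinder, HomologicalComplex.comp_f]
  have : Function.Surjective ((eqToHom (cocylinder_obj F p)).f n) := by
    rw [← ModuleCat.epi_iff_surjective]
    infer_instance
  exact (cocylπ_surjective _ n).comp this

end

/-- For `q < p` the elements below `q` are the same in `P_{<p}` and in `P`, so the extension
problems coincide. -/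
theorem IsFlasque.restrictLT {F : Pᵒᵖ ⥤ Ch R} (hF : IsFlasque F) (p : P) :
    IsFlasque (restrictLT F p) := by
  classical
  intro q n x hx
  let y : ∀ r, (F.obj (op r)).X n := fun r => if h : r < p then x ⟨r, h⟩ else 0
  have hy : ∀ r, ∀ h : r < p, y r = x ⟨r, h⟩ := fun r h => dif_pos h
  obtain ⟨z, hz⟩ := hF q.1 n y (fun r hr s hs => by
    have hr' : r < p := hr.trans q.2
    rw [hy r hr', hy s (hs.trans hr')]
    exact hx ⟨r, hr'⟩ hr ⟨s, hs.trans hr'⟩ hs)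
  exact ⟨z, fun r hr => (hz r.1 hr).trans (hy r.1 r.2)⟩

theorem IsPointwiseQuasiIso.restrictLTMap {F G : Pᵒᵖ ⥤ Ch R} {η : F ⟶ G}
    (hη : IsPointwiseQuasiIso η) (p : P) : IsPointwiseQuasiIso (restrictLTMap η p) :=
  fun q => hη q.1

end Cocylinder

end

/-! ### The main theorem -/

theorem mainTheorem9 (R : Type u) [CommRing R] (P : Type u) [PartialOrder P] [FilteredPoset P] :
    ∃ _M : ModelCategory (Pᵒᵖ ⥤ Ch R),
      -- weak equivalences, cofibrations, fibrations and fibrant objects of the model structure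
      (∀ {F G : Pᵒᵖ ⥤ Ch R} (η : F ⟶ G),
        WeakEquivalence η ↔
          ∀ (p : P) (n : ℤ), IsIso (HomologicalComplex.homologyMap (η.app (op p)) n)) ∧
      (∀ {F G : Pᵒᵖ ⥤ Ch R} (η : F ⟶ G),
        Cofibration η ↔ ∀ p : P, projectiveCofibrations R (η.app (op p))) ∧
      (∀ {F G : Pᵒᵖ ⥤ Ch R} (η : F ⟶ G),
        Fibration η ↔
          ∀ (p : P) (n : ℤ), Function.Surjective ((relativeMatchingMap η p).f n)) ∧
      (∀ G : Pᵒᵖ ⥤ Ch R,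
        IsFibrant G ↔ ∀ (p : P) (n : ℤ), Function.Surjective ((matchingMap G p).f n)) ∧
      -- any fibrant replacement computes cohomology
      (∀ (F : Pᵒᵖ ⥤ ModuleCat.{u} R) (G : Pᵒᵖ ⥤ Ch R) (i : inDegreeZero F ⟶ G),
        IsFibrantReplacement i → ComputesCohomology F (limit G)) ∧
      -- the cocylinder is a fibrant replacement, and computes the cohomology of the rays
      ∀ F : Pᵒᵖ ⥤ ModuleCat.{u} R,
        IsFibrantReplacement (cocylinderι (inDegreeZero F)) ∧
          ∀ p : P, ComputesCohomology (restrictLT F p)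
            (limit (restrictLT (cocylinder (inDegreeZero F)) p)) := by
  let _ := posetModelCategory R P
  refine ⟨posetModelCategory R P, fun η => weakEquivalence_iff η, fun η => cofibration_iff η,
    fun η => (fibration_iff η).trans (relativeMatchingMap_surjective_iff η).symm,
    fun G => (isFibrant_iff_isFlasque G).trans matchingMap_surjective_iff.symm,
    fun F G i hi => computesCohomology_of_flasque i ((weakEquivalence_iff i).1 hi.1)
      ((isFibrant_iff_isFlasque G).1 hi.2),
    fun F => ⟨⟨(weakEquivalence_iff _).2 (isPointwiseQuasiIso_cocylinderι _),
      (isFibrant_iff_isFlasque _).2 (isFlasque_cocylinder _)⟩, fun p => ?_⟩⟩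
  -- The restriction of `F → RF` is itself a flasque replacement over `P_{<p}`; no comparison with
  -- the cocylinder of the restricted functor is needed.
  exact computesCohomology_of_flasque (F := restrictLT F p)
    (restrictLTMap (cocylinderι (inDegreeZero F)) p)
    ((isPointwiseQuasiIso_cocylinderι _).restrictLTMap p) ((isFlasque_cocylinder _).restrictLT p)
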